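/- For $k\in\mathbb N$ let $\mathcal L_1^{\mathrm{loc}}(\mathbb R,\mathbb R^k)$ be the locally integrable functions (identified when equal almost everywhere), and let $\mathcal D_+(\mathbb R,\mathbb R^k)$ be the infinitely differentiable functions whose support is bounded on the left. Differential equations are understood in the weak sense: for a real polynomial matrix $R(\xi)=R_0+R_1\xi+\cdots+R_L\xi^L$ of degree $L$ and $w$ locally integrable, $R(\tfrac{d}{dt})w=0$ means that there are constant vectors $c_0,\dots,c_{L-1}$ with $$R_Lw(t)+R_{L-1}(\textstyle\int w)(t)+\cdots+R_0(\textstyle\int^{L}w)(t)=c_0+c_1t+\cdots+c_{L-1}t^{L-1}\quad\text{for almost all }t,$$ where $(\int w)(t)=\int_0^tw(\tau)\,d\tau$ and $\int^k$ is its $k$-th iterate. Let $\hat P,\hat Q\in\mathbb R^{n\times n}[\xi]$, with $\hat Q$ nonsingular (that is, $\det\hat Q\neq 0$) and every entry of $\hat Q^{-1}\hat P$ a proper rational function, and let $$\hat{\mathcal B}=\{(u,y)\in\mathcal L_1^{\mathrm{loc}}(\mathbb R,\mathbb R^n)\times\mathcal L_1^{\mathrm{loc}}(\mathbb R,\mathbb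 R^n)\mid \hat P(\tfrac{d}{dt})u=\hat Q(\tfrac{d}{dt})y\}$$ ($\hat{\mathcal B}$ need not be controllable). Then the following are equivalent. 1. $\hat{\mathcal B}$ is reciprocal: for all $(u_a,y_a),(u_b,y_b)\in\hat{\mathcal B}\cap(\mathcal D_+(\mathbb R,\mathbb R^n)\times\mathcal D_+(\mathbb R,\mathbb R^n))$ one has $y_b\star u_a=u_b\star y_a$, where $(w_1\star w_2)(t)=\int_{-\infty}^{\infty}w_1(\tau)^Tw_2(t-\tau)\,d\tau$. 2. There are an integer $d\ge 0$, matrices $A\in\mathbb R^{d\times d}$, $B\in\mathbb R^{d\times n}$, $C\in\mathbb R^{n\times d}$, $D\in\mathbb R^{n\times n}$, and a signature matrix $\Sigma\in\mathbb R^{d\times d}$ (a diagonal matrix with all diagonal entries equal to $1$ or $-1$) such that (i) $\hat{\mathcal B}$ is the external behavior of the state-space system $(A,B,C,D)$, that is, $(u,y)\in\hat{\mathcal B}$ if and only if $u,y\in\mathcal L_1^{\mathrm{loc}}(\mathbb R,\mathbb R^n)$ and there is $x\in\mathcal L_1^{\mathrm{loc}}(\mathbb R,\mathbb R^d)$ with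 $\tfrac{dx}{dt}=Ax+Bu$ (weakly) and $y=Cx+Du$ (almost everywhere); and (ii) $A\Sigma=\Sigma A^T$, $\Sigma C^T=B$ and $D=D^T$. -/

import Mathlib

open MeasureTheory Polynomial
open scoped ContDiff

noncomputable section

namespace Behavioral

/-! ### Weak solutions of linear constant-coefficient differential equations

Trajectories are represented by functions `ℝ → κ → ℝ`.  Every behavior below is invariant under
modification of its trajectories on null sets, so equality of sets of representatives is the same
as equality of sets of almost-everywhere classes. -/

/-- The integral operator `(∫ f)(t) = ∫_0^t f(τ) dτ`. -/
def integ (f : ℝ → ℝ) : ℝ → ℝ := fun t => ∫ τ in (0 : ℝ)..t, f τ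

/-- The degree `L` of a polynomial matrix `R(ξ) = R_0 + R_1 ξ + ⋯ + R_L ξ ^ L`. -/
def matDegree {ι κ : Type*} [Fintype ι] [Fintype κ] (R : Matrix ι κ ℝ[X]) : ℕ :=
  Finset.univ.sup fun i => Finset.univ.sup fun j => (R i j).natDegree

/-- `w` solves `R(d/dt) w = 0` weakly, in the sense of Polderman and Willems (*Introduction to
Mathematical Systems Theory*, Section 2.3.2).  With `R(ξ) = R_0 + R_1 ξ + ⋯ + R_L ξ ^ L`, the
`L`-fold integrated equation
`R_L w + R_{L-1} (∫ w) + ⋯ + R_0 (∫^L w) = c_0 + c_1 t + ⋯ + c_{L-1} t ^ (L-1)`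
holds for almost all `t`, for some constant vectors `c_0, …, c_{L-1}`.  The right-hand side is
written as a vector `c` of polynomials of degree less than `L`. -/
def IsWeakSolution {ι κ : Type*} [Fintype ι] [Fintype κ] (R : Matrix ι κ ℝ[X])
    (w : ℝ → κ → ℝ) : Prop :=
  ∃ c : ι → ℝ[X], (∀ i, (c i).degree < (matDegree R : WithBot ℕ)) ∧
    ∀ᵐ t : ℝ, ∀ i,
      ∑ j, ∑ k ∈ Finset.range (matDegree R + 1),
        (R i j).coeff k * (integ^[matDegree R - k] fun s => w s j) t = (c i).eval t

/-! ### Input-output and state-space behaviors -/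

/-- The behavior `{(u, y) ∈ L₁ˡᵒᶜ × L₁ˡᵒᶜ | P(d/dt) u = Q(d/dt) y}`, that is, the kernel of
`[P  -Q]` acting on `col(u, y)`. -/
def ioBehavior {n : ℕ} (P Q : Matrix (Fin n) (Fin n) ℝ[X]) :
    Set ((ℝ → Fin n → ℝ) × (ℝ → Fin n → ℝ)) :=
  {p | LocallyIntegrable p.1 ∧ LocallyIntegrable p.2 ∧
    IsWeakSolution (Matrix.fromCols P (-Q)) (fun t => Sum.elim (p.1 t) (p.2 t))}

/-- The state-space behavior
`{(u, y, x) ∈ L₁ˡᵒᶜ × L₁ˡᵒᶜ × L₁ˡᵒᶜ | dx/dt = A x + B u and y = C x + D u}`.  The state equation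
is `(ξ I - A)(d/dt) x - B u = 0`, in the weak sense; the output equation holds almost
everywhere. -/
def stateSpaceBehavior {n d : ℕ} (A : Matrix (Fin d) (Fin d) ℝ) (B : Matrix (Fin d) (Fin n) ℝ)
    (C : Matrix (Fin n) (Fin d) ℝ) (D : Matrix (Fin n) (Fin n) ℝ) :
    Set ((ℝ → Fin n → ℝ) × (ℝ → Fin n → ℝ) × (ℝ → Fin d → ℝ)) :=
  {p | LocallyIntegrable p.1 ∧ LocallyIntegrable p.2.1 ∧ LocallyIntegrable p.2.2 ∧
    IsWeakSolution (Matrix.fromCols A.charmatrix (-(B.map Polynomial.C)))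
      (fun t => Sum.elim (p.2.2 t) (p.1 t)) ∧
    ∀ᵐ t : ℝ, p.2.1 t = C.mulVec (p.2.2 t) + D.mulVec (p.1 t)}

/-- The external behavior of a state-space system: the projection onto `(u, y)`. -/
def externalBehavior {n d : ℕ} (A : Matrix (Fin d) (Fin d) ℝ) (B : Matrix (Fin d) (Fin n) ℝ)
    (C : Matrix (Fin n) (Fin d) ℝ) (D : Matrix (Fin n) (Fin n) ℝ) :
    Set ((ℝ → Fin n → ℝ) × (ℝ → Fin n → ℝ)) :=
  {p | ∃ x : ℝ → Fin d → ℝ, (p.1, p.2, x) ∈ stateSpaceBehavior A B C D}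

/-! ### Proper rational matrices and signature matrices -/

/-- A rational function is proper if it is bounded at infinity, that is, the degree of the
numerator does not exceed that of the denominator. -/
def IsProperRat (r : RatFunc ℝ) : Prop := r.num.degree ≤ r.denom.degree

/-- The matrix of rational functions `Q⁻¹ P`. -/
def transferMatrix {n : ℕ} (P Q : Matrix (Fin n) (Fin n) ℝ[X]) :
    Matrix (Fin n) (Fin n) (RatFunc ℝ) :=
  (Q.map (algebraMap ℝ[X] (RatFunc ℝ)))⁻¹ * P.map (algebraMap ℝ[X] (RatFunc ℝ))

/-- A signature matrix is a diagonal matrix all of whose diagonal entries are `1` or `-1`. -/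
def IsSignature {d : ℕ} (S : Matrix (Fin d) (Fin d) ℝ) : Prop :=
  S.IsDiag ∧ ∀ i, S i i = 1 ∨ S i i = -1

/-! ### Reciprocity -/

/-- Infinitely differentiable functions with support bounded on the left. -/
def DPlus (n : ℕ) : Set (ℝ → Fin n → ℝ) :=
  {w | ContDiff ℝ ∞ w ∧ ∃ T : ℝ, ∀ t < T, w t = 0}

/-- The convolution `(w₁ ⋆ w₂)(t) = ∫ w₁(τ)ᵀ w₂(t - τ) dτ`. -/
def conv {n : ℕ} (w₁ w₂ : ℝ → Fin n → ℝ) : ℝ → ℝ :=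
  fun t => ∫ τ : ℝ, w₁ τ ⬝ᵥ w₂ (t - τ)

/-- A behavior is reciprocal if `v_b ⋆ i_a = i_b ⋆ v_a` for any two of its trajectories
`(i_a, v_a)` and `(i_b, v_b)` in `D₊ × D₊`. -/
def IsReciprocal {n : ℕ} (𝓑 : Set ((ℝ → Fin n → ℝ) × (ℝ → Fin n → ℝ))) : Prop :=
  ∀ a ∈ 𝓑 ∩ DPlus n ×ˢ DPlus n, ∀ b ∈ 𝓑 ∩ DPlus n ×ˢ DPlus n,
    conv b.2 a.1 = conv b.1 a.2

end Behavioral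

end

/-!
# Reciprocal behaviors are those with a signature-symmetric realization

Both conditions are compared with the symmetry of `Q⁻¹ P`, written as `P Qᵀ = Q Pᵀ`.

*Weak solutions.*  A locally integrable function is identified with a linear functional on test
functions (`toDistr`); such functionals form a module over `ℝ[X]` with `X` acting as `d/dt`.
Since the only functionals with zero derivative are the constants, `R(d/dt) w = 0` holds weakly
if and only if the polynomial matrix `R` annihilates `w` in this module (`isWeakSolution_iff`).
Elimination of states is then a computation with polynomial matrices.

*Realization.*  Let `M` be the module of polynomial row vectors modulo the rows of `Q`; it is
finite-dimensional because `det Q ≠ 0`.  Multiplication by `ξ` in a basis of `M` is the state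
matrix `A`, the unit vectors give the output matrix `C`, and division by `ξ I - A` gives `B` and,
thanks to properness, a constant `D` (`exists_realization`).  This realization is observable, so
its state is a polynomial differential operator applied to `(u, y)`, and its external behavior is
exactly the given one, controllable or not (`Realization.act_eq_iff`).

*Reciprocity implies symmetry of `Q⁻¹ P`.*  The trajectories
`u = (det Q)(d/dt) φ e_k`, `y = (adj(Q) P)(d/dt) φ e_k` with `φ` a test function have compact
support, and the Laplace transform of the reciprocity relation says that `adj(Q) P` is symmetric
(`mul_transpose_eq_of_isReciprocal`).

*Symmetry implies a signature-symmetric realization.*  If `Q⁻¹ P` is symmetric, there is a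
symmetric `Φ`, possibly singular, with `A Φ = Φ Aᵀ`, `Φ Cᵀ = B` and `C Φ = Bᵀ`
(`Realization.exists_intertwiner`).  Put the system and its dual side by side, each with half of
the transfer matrix:
`s' = A s + (1/2) B u`, `δ' = Aᵀ δ + 2 Cᵀ u`, `y = C s + (1/4) Bᵀ δ + D u`.
By the relations for `Φ`, the vector `s + (1/4) Φ δ` is a state of the original system, so the
external behavior has not changed.  The duality pairing between `s` and `δ` is diagonalized
by sums and differences, which gives the signature matrix `diag(I, -I)`
(`exists_signature_realization`).

*A signature-symmetric realization implies reciprocity.*  Trajectories vanishing near `-∞` have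
states vanishing near `-∞` (`exists_state_of_mem_DPlus`), and
`y_b(τ) · u_a(t - τ) - u_b(τ) · y_a(t - τ)` is the derivative in `τ` of `-x_b(τ) · S x_a(t - τ)`, so
its integral is zero (`isReciprocal_externalBehavior`).
-/

noncomputable section

namespace Behavioral

/-! ### Distributions as a module over the polynomial ring -/

/-- Compactly supported smooth functions on the line. -/
def testFunctions : Submodule ℝ (ℝ → ℝ) where
  carrier := {φ | ContDiff ℝ ∞ φ ∧ HasCompactSupport φ}
  add_mem' hf hg := ⟨hf.1.add hg.1, hf.2.add hg.2⟩
  zero_mem' := ⟨contDiff_const, HasCompactSupport.zero⟩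
  smul_mem' c _ hf := ⟨contDiff_const.smul hf.1, hf.2.smul_left (f := fun _ => c)⟩

/-- The type of compactly supported smooth functions on the line. -/
abbrev TestFun : Type := testFunctions

namespace TestFun

lemma contDiff (φ : TestFun) : ContDiff ℝ ∞ (φ : ℝ → ℝ) := φ.2.1

lemma hasCompactSupport (φ : TestFun) : HasCompactSupport (φ : ℝ → ℝ) := φ.2.2

lemma continuous (φ : TestFun) : Continuous (φ : ℝ → ℝ) := φ.contDiff.continuous

lemma differentiable (φ : TestFun) : Differentiable ℝ (φ : ℝ → ℝ) :=
  φ.contDiff.differentiable (by simp)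

lemma integrable (φ : TestFun) : Integrable (φ : ℝ → ℝ) :=
  φ.continuous.integrable_of_hasCompactSupport φ.hasCompactSupport

/-- Differentiation of test functions. -/
def deriv : Module.End ℝ TestFun where
  toFun φ := ⟨_root_.deriv (φ : ℝ → ℝ),
    (contDiff_infty_iff_deriv.1 φ.contDiff).2, φ.hasCompactSupport.deriv⟩
  map_add' φ ψ := by
    ext t
    exact deriv_add (φ.differentiable t) (ψ.differentiable t)
  map_smul' c φ := by
    ext t
    exact deriv_const_smul c (φ.differentiable t)

@[simp] lemma coe_deriv (φ : TestFun) :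
    ((deriv φ : TestFun) : ℝ → ℝ) = _root_.deriv (φ : ℝ → ℝ) := rfl

lemma hasDerivAt (φ : TestFun) (t : ℝ) :
    HasDerivAt (φ : ℝ → ℝ) ((deriv φ : ℝ → ℝ) t) t :=
  (φ.differentiable t).hasDerivAt

end TestFun

/-- Locally integrable functions on the line. -/
def locallyIntegrableFunctions : Submodule ℝ (ℝ → ℝ) where
  carrier := {f | LocallyIntegrable f volume}
  add_mem' hf hg := LocallyIntegrable.add hf hg
  zero_mem' := locallyIntegrable_zero
  smul_mem' c _ hf := LocallyIntegrable.smul hf c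

/-- The type of locally integrable functions on the line. -/
abbrev LocInt : Type := locallyIntegrableFunctions

lemma intervalIntegrable_of_locallyIntegrable {f : ℝ → ℝ} (hf : LocallyIntegrable f) (a b : ℝ) :
    IntervalIntegrable f volume a b :=
  (intervalIntegrable_iff' (by simp)).2 (hf.integrableOn_isCompact isCompact_uIcc)

/-- Linear functionals on test functions.  They form a module over `ℝ[X]` on which `X` acts as
differentiation, `w ↦ (φ ↦ -w (φ'))`.  No continuity is required of the functionals: none of the
arguments below needs it. -/
def Distr : Type := Module.Dual ℝ TestFun

instance : AddCommGroup Distr := inferInstanceAs (AddCommGroup (Module.Dual ℝ TestFun))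

instance : Module ℝ Distr := inferInstanceAs (Module ℝ (Module.Dual ℝ TestFun))

/-- The value of a functional at a test function. -/
def Distr.eval (w : Distr) (φ : TestFun) : ℝ := (show Module.Dual ℝ TestFun from w) φ

/-- Differentiation of functionals on test functions. -/
def distrDeriv : Module.End ℝ Distr := -(LinearMap.dualMap TestFun.deriv)

/-- A polynomial `p` acts as `p(d/dt)`. -/
instance : Module ℝ[X] Distr := Module.compHom Distr (aeval distrDeriv).toRingHom

namespace Distr

@[ext] lemma ext {v w : Distr} (h : ∀ φ, v.eval φ = w.eval φ) : v = w :=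
  LinearMap.ext (f := (show Module.Dual ℝ TestFun from v)) h

@[simp] lemma eval_zero (φ) : (0 : Distr).eval φ = 0 := rfl

@[simp] lemma eval_smul (c : ℝ) (w : Distr) (φ) : (c • w).eval φ = c * w.eval φ := rfl

lemma smul_eq_aeval (p : ℝ[X]) (w : Distr) : p • w = aeval distrDeriv p w := rfl

lemma C_smul (c : ℝ) (w : Distr) : C c • w = c • w := by
  rw [smul_eq_aeval, aeval_C, Module.algebraMap_end_apply]

instance : IsScalarTower ℝ ℝ[X] Distr where
  smul_assoc c p w := by
    rw [smul_eq_aeval, map_smul, LinearMap.smul_apply, smul_eq_aeval]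

@[simp] lemma eval_X_smul (w : Distr) (φ) :
    ((X : ℝ[X]) • w).eval φ = - w.eval (TestFun.deriv φ) := by
  rw [smul_eq_aeval, aeval_X]
  rfl

lemma eval_arg_add (w : Distr) (φ ψ) : w.eval (φ + ψ) = w.eval φ + w.eval ψ :=
  map_add (show Module.Dual ℝ TestFun from w) φ ψ

lemma eval_arg_smul (w : Distr) (c : ℝ) (φ) : w.eval (c • φ) = c * w.eval φ :=
  map_smul (show Module.Dual ℝ TestFun from w) c φ

end Distr

lemma LocInt.integrable_mul (f : LocInt) (φ : TestFun) :
    Integrable (fun t => (f : ℝ → ℝ) t * (φ : ℝ → ℝ) t) :=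
  LocallyIntegrable.integrable_smul_right_of_hasCompactSupport f.2 φ.continuous
    φ.hasCompactSupport

/-- The functional `φ ↦ ∫ f φ` attached to a locally integrable function `f`. -/
def toDistr : LocInt →ₗ[ℝ] Distr :=
  LinearMap.mk₂ ℝ (fun (f : LocInt) (φ : TestFun) => ∫ t, (f : ℝ → ℝ) t * (φ : ℝ → ℝ) t)
    (fun f g φ => by
      rw [← integral_add (f.integrable_mul φ) (g.integrable_mul φ)]
      simp [add_mul])
    (fun c f φ => by
      rw [smul_eq_mul, ← integral_const_mul]
      simp [mul_assoc])
    (fun f φ ψ => by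
      rw [← integral_add (f.integrable_mul φ) (f.integrable_mul ψ)]
      simp [mul_add])
    (fun c f φ => by
      rw [smul_eq_mul, ← integral_const_mul]
      simp [mul_left_comm])

lemma toDistr_eval (f : LocInt) (φ : TestFun) :
    (toDistr f).eval φ = ∫ t, (f : ℝ → ℝ) t * (φ : ℝ → ℝ) t := rfl

lemma toDistr_eq_iff (f g : LocInt) :
    toDistr f = toDistr g ↔ (f : ℝ → ℝ) =ᵐ[volume] (g : ℝ → ℝ) := by
  constructor
  · intro h
    refine ae_eq_of_integral_contDiff_smul_eq f.2 g.2 fun φ hφ hφ' => ?_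
    have := congrArg (fun w => w.eval (⟨φ, hφ, hφ'⟩ : TestFun)) h
    simpa [toDistr_eval, mul_comm] using this
  · intro h
    ext φ
    rw [toDistr_eval, toDistr_eval]
    refine integral_congr_ae ?_
    filter_upwards [h] with t ht
    rw [ht]

/-! ### Primitives, and the kernel of differentiation -/

lemma integ_add {f g : ℝ → ℝ} (hf : LocallyIntegrable f) (hg : LocallyIntegrable g) :
    integ (f + g) = integ f + integ g := by
  ext t
  exact intervalIntegral.integral_add 
    (intervalIntegrable_of_locallyIntegrable hf _ _)
    (intervalIntegrable_of_locallyIntegrable hg _ _)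

lemma continuous_integ {f : ℝ → ℝ} (hf : LocallyIntegrable f) : Continuous (integ f) :=
  intervalIntegral.continuous_primitive (intervalIntegrable_of_locallyIntegrable hf) 0

/-- The integral operator on locally integrable functions. -/
def primitive : Module.End ℝ LocInt where
  toFun f := ⟨integ f, (continuous_integ f.2).locallyIntegrable⟩
  map_add' f g := Subtype.ext (integ_add f.2 g.2)
  map_smul' c f := by
    ext t
    simp [integ]

@[simp] lemma coe_primitive (f : LocInt) :
    ((primitive f : LocInt) : ℝ → ℝ) = integ f := rfl

lemma coe_primitive_pow (k : ℕ) (f : LocInt) :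
    (((primitive ^ k) f : LocInt) : ℝ → ℝ) = integ^[k] f := by
  induction k with
  | zero => rfl
  | succ k ih => rw [pow_succ', Function.iterate_succ_apply', ← ih]; rfl

lemma TestFun.exists_bound (φ : TestFun) :
    ∃ R : ℝ, 0 < R ∧ ∀ t, R ≤ |t| → (φ : ℝ → ℝ) t = 0 := by
  obtain ⟨R, hR, h⟩ := φ.hasCompactSupport.exists_pos_le_norm
  exact ⟨R, hR, h⟩

lemma integral_eq_intervalIntegral {f : ℝ → ℝ} {R : ℝ}
    (h : ∀ t, R ≤ |t| → f t = 0) : ∫ t, f t = ∫ t in (-R)..R, f t := by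
  refine (intervalIntegral.integral_eq_integral_of_support_subset ?_).symm
  intro t ht
  by_contra hc
  refine ht (h t ?_)
  by_contra! h'
  exact hc ⟨(abs_lt.1 h').1, (abs_lt.1 h').2.le⟩

/-- Integration by parts: the primitive of a locally integrable function is absolutely
continuous. -/
lemma X_smul_toDistr_primitive (f : LocInt) :
    (X : ℝ[X]) • toDistr (primitive f) = toDistr f := by
  ext φ
  rw [Distr.eval_X_smul, toDistr_eval, toDistr_eval]
  obtain ⟨R, hR, hφ⟩ := φ.exists_bound
  have hφ' : ∀ t, R < |t| → ((TestFun.deriv φ : TestFun) : ℝ → ℝ) t = 0 := by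
    intro t ht
    have : (φ : ℝ → ℝ) =ᶠ[nhds t] fun _ => 0 := by
      filter_upwards [(continuous_abs.tendsto t).eventually (lt_mem_nhds ht)] with s hs
      exact hφ s hs.le
    rw [TestFun.coe_deriv, this.deriv_eq]
    simp
  have hR1 : 0 < R + 1 := by linarith
  rw [integral_eq_intervalIntegral (R := R + 1), integral_eq_intervalIntegral (R := R + 1)]
  · have hac := (intervalIntegrable_of_locallyIntegrable f.2 (-(R+1))
      (R+1)).absolutelyContinuousOnInterval_intervalIntegral (c := 0)
      (by rw [Set.mem_uIcc]; left; constructor <;> linarith)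
    have hac2 : AbsolutelyContinuousOnInterval (φ : ℝ → ℝ) (-(R+1)) (R+1) :=
      ((φ.contDiff.of_le (by exact_mod_cast le_top)).contDiffOn).absolutelyContinuousOnInterval
    have := hac.integral_mul_deriv_eq_deriv_mul hac2
    rw [coe_primitive, TestFun.coe_deriv]
    have e : ∀ t, integ (f : ℝ → ℝ) t = ∫ (t : ℝ) in 0..t, (f : ℝ → ℝ) t := fun t => rfl
    simp only [e]
    rw [this, hφ (R+1) (by rw [abs_of_pos hR1]; linarith),
      hφ (-(R+1)) (by rw [abs_neg, abs_of_pos hR1]; linarith)]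
    simp only [mul_zero, sub_zero, zero_sub, neg_neg]
    refine intervalIntegral.integral_congr_ae ?_
    filter_upwards [_root_.LocallyIntegrable.ae_hasDerivAt_integral f.2] with t ht _
    rw [(ht 0).deriv]
  · intro t ht
    rw [hφ t (by linarith), mul_zero]
  · intro t ht
    rw [hφ' t (by linarith), mul_zero]

lemma X_pow_smul_toDistr_primitive_pow (k : ℕ) (f : LocInt) :
    (X ^ k : ℝ[X]) • toDistr ((primitive ^ k) f) = toDistr f := by
  induction k with
  | zero => simp
  | succ k ih =>
    rw [pow_succ, mul_smul, pow_succ', Module.End.mul_apply, X_smul_toDistr_primitive, ih]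

/-- A continuous function, as a locally integrable one. -/
def ofCont (f : ℝ → ℝ) (hf : Continuous f) : LocInt := ⟨f, hf.locallyIntegrable⟩

@[simp] lemma coe_ofCont (f : ℝ → ℝ) (hf : Continuous f) : (ofCont f hf : ℝ → ℝ) = f := rfl

/-- The distribution of the constant function `1`. -/
def oneDistr : Distr := toDistr (ofCont (fun _ => 1) continuous_const)

lemma X_smul_oneDistr : (X : ℝ[X]) • oneDistr = 0 := by
  ext φ
  rw [Distr.eval_X_smul, oneDistr, toDistr_eval]
  simp only [coe_ofCont, one_mul, Distr.eval_zero, neg_eq_zero]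
  exact integral_eq_zero_of_hasDerivAt_of_integrable φ.hasDerivAt
    (TestFun.deriv φ).integrable φ.integrable

/-- The derivative of a `C¹` function in the sense of distributions is its derivative. -/
lemma X_smul_toDistr_of_hasDerivAt {f f' : ℝ → ℝ} (hf' : Continuous f')
    (h : ∀ t, HasDerivAt f (f' t) t) (hf : Continuous f) :
    (X : ℝ[X]) • toDistr (ofCont f hf) = toDistr (ofCont f' hf') := by
  have : ofCont f hf =
      primitive (ofCont f' hf') + (f 0) • ofCont (fun _ => 1) continuous_const := by
    ext t
    have := intervalIntegral.integral_eq_sub_of_hasDerivAt (a := 0) (b := t) (fun s _ => h s)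
      (hf'.intervalIntegrable _ _)
    simp [integ, this]
  rw [this, map_add, smul_add, X_smul_toDistr_primitive, map_smul, ← smul_comm]
  have := X_smul_oneDistr
  rw [oneDistr] at this
  rw [this]
  simp

/-- A nonnegative bump function at the origin, of integral one. -/
lemma exists_testFun_integral_eq_one : ∃ φ : TestFun, (∀ t, 0 ≤ (φ : ℝ → ℝ) t) ∧
    0 < (φ : ℝ → ℝ) 0 ∧ ∫ t, (φ : ℝ → ℝ) t = 1 := by
  let b : ContDiffBump (0 : ℝ) := ⟨1, 2, one_pos, one_lt_two⟩
  refine ⟨⟨b.normed volume, b.contDiff_normed, b.hasCompactSupport_normed⟩, ?_, ?_, ?_⟩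
  · exact fun t => b.nonneg_normed t
  · change 0 < b 0 / _
    refine div_pos ?_ b.integral_pos
    exact b.pos_of_mem_ball (by simp [b])
  · exact b.integral_normed

lemma TestFun.exists_deriv_eq (φ : TestFun) (h : ∫ t, (φ : ℝ → ℝ) t = 0) :
    ∃ ψ : TestFun, TestFun.deriv ψ = φ := by
  obtain ⟨R, hR, hφ⟩ := φ.exists_bound
  let ψ : ℝ → ℝ := fun t => ∫ s in (-R)..t, (φ : ℝ → ℝ) s
  have hd : ∀ t, HasDerivAt ψ ((φ : ℝ → ℝ) t) t := fun t =>
    intervalIntegral.integral_hasDerivAt_right (φ.continuous.intervalIntegrable _ _)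
      (φ.continuous.stronglyMeasurableAtFilter _ _) φ.continuous.continuousAt
  have hderiv : _root_.deriv ψ = φ := funext fun t => (hd t).deriv
  have hout : ∀ t, R < |t| → ψ t = 0 := by
    intro t ht
    rcases lt_abs.1 ht with h1 | h1
    · have e : ψ t = ψ R + ∫ s in R..t, (φ : ℝ → ℝ) s :=
        (intervalIntegral.integral_add_adjacent_intervals
          (φ.continuous.intervalIntegrable _ _) (φ.continuous.intervalIntegrable _ _)).symm
      have e1 : ψ R = 0 := by
        rw [← h, integral_eq_intervalIntegral hφ]
      rw [e, e1, zero_add]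
      refine intervalIntegral.integral_zero_ae (Filter.Eventually.of_forall fun s hs => hφ s ?_)
      rw [Set.uIoc_of_le h1.le] at hs
      exact hs.1.le.trans (le_abs_self s)
    · refine intervalIntegral.integral_zero_ae (Filter.Eventually.of_forall fun s hs => hφ s ?_)
      rw [Set.uIoc_of_ge (by linarith)] at hs
      have := hs.2
      exact le_trans (by linarith) (neg_le_abs s)
  refine ⟨⟨ψ, ?_, ?_⟩, Subtype.ext hderiv⟩
  · exact contDiff_infty_iff_deriv.2 ⟨fun t => (hd t).differentiableAt, hderiv ▸ φ.contDiff⟩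
  · refine HasCompactSupport.intro (isCompact_Icc (a := -R) (b := R)) fun t ht => hout t ?_
    by_contra! hc
    exact ht (abs_le.1 hc)

/-- The only distributions with zero derivative are the constants. -/
lemma exists_eq_const_of_X_smul_eq_zero {w : Distr} (hw : (X : ℝ[X]) • w = 0) :
    ∃ c : ℝ, w = c • oneDistr := by
  obtain ⟨φ₀, -, -, h₀⟩ := exists_testFun_integral_eq_one
  refine ⟨w.eval φ₀, ?_⟩
  ext φ
  set m := ∫ t, (φ : ℝ → ℝ) t with hm
  obtain ⟨ψ, hψ⟩ := TestFun.exists_deriv_eq (φ + (-m) • φ₀) (by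
    have : ∀ t, ((φ + (-m) • φ₀ : TestFun) : ℝ → ℝ) t
      = (φ : ℝ → ℝ) t + (-m) * (φ₀ : ℝ → ℝ) t := fun t => rfl
    simp_rw [this]
    rw [integral_add φ.integrable (φ₀.integrable.const_mul _), integral_const_mul, h₀]
    simp [hm])
  have := congrArg (fun v => v.eval ψ) hw
  simp only [Distr.eval_X_smul, hψ, Distr.eval_zero, Distr.eval_arg_add,
    Distr.eval_arg_smul] at this
  rw [Distr.eval_smul, oneDistr, toDistr_eval]
  simp only [coe_ofCont, one_mul]
  rw [← hm]
  linarith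

/-! ### Polynomial matrices acting on vectors of module elements -/

section PolynomialMatrixAction

variable {R V ι κ μ : Type*} [CommRing R] [AddCommGroup V] [Module R V]
  [Fintype κ] [Fintype μ]

/-- The action of a matrix over `R` on a vector with entries in an `R`-module. -/
def act (M : Matrix ι κ R) (w : κ → V) : ι → V := fun i => ∑ j, M i j • w j

lemma act_mul (M : Matrix ι κ R) (N : Matrix κ μ R) (w : μ → V) :
    act (M * N) w = act M (act N w) := by
  ext i
  simp only [act, Matrix.mul_apply, Finset.sum_smul, Finset.smul_sum, mul_smul]
  exact Finset.sum_comm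

lemma act_add (M N : Matrix ι κ R) (w : κ → V) : act (M + N) w = act M w + act N w := by
  ext i
  simp [act, add_smul, Finset.sum_add_distrib]

lemma act_sub (M N : Matrix ι κ R) (w : κ → V) : act (M - N) w = act M w - act N w := by
  ext i
  simp [act, sub_smul, Finset.sum_sub_distrib]

lemma act_neg (M : Matrix ι κ R) (w : κ → V) : act (-M) w = - act M w := by
  ext i
  simp [act, Finset.sum_neg_distrib]

lemma act_zero (M : Matrix ι κ R) : act M (0 : κ → V) = 0 := by
  ext i
  simp [act]

lemma act_vadd (M : Matrix ι κ R) (v w : κ → V) : act M (v + w) = act M v + act M w := by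
  ext i
  simp [act, smul_add, Finset.sum_add_distrib]

lemma act_vsub (M : Matrix ι κ R) (v w : κ → V) : act M (v - w) = act M v - act M w := by
  ext i
  simp [act, smul_sub, Finset.sum_sub_distrib]

lemma act_smul (M : Matrix ι κ R) (c : R) (w : κ → V) : act M (c • w) = c • act M w := by
  ext i
  simp only [act, Pi.smul_apply, Finset.smul_sum]
  exact Finset.sum_congr rfl fun j _ => smul_comm _ _ _

lemma act_one [DecidableEq κ] (w : κ → V) : act (1 : Matrix κ κ R) w = w := by
  ext i
  simp [act, Matrix.one_apply, ite_smul]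

lemma act_smul_one [DecidableEq κ] (c : R) (w : κ → V) :
    act (c • (1 : Matrix κ κ R)) w = c • w := by
  ext i
  simp [act, Matrix.one_apply, ite_smul]

lemma act_fromCols (M : Matrix ι κ R) (N : Matrix ι μ R) (v : κ → V) (w : μ → V) :
    act (Matrix.fromCols M N) (Sum.elim v w) = act M v + act N w := by
  ext i
  simp [act]

end PolynomialMatrixAction

/-- A real matrix, as a polynomial matrix. -/
abbrev const {ι κ : Type*} (M : Matrix ι κ ℝ) : Matrix ι κ ℝ[X] := M.map Polynomial.C

lemma const_mul {ι κ μ : Type*} [Fintype κ] (M : Matrix ι κ ℝ) (N : Matrix κ μ ℝ) :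
    const (M * N) = const M * const N :=
  Matrix.map_mul

lemma const_add {ι κ : Type*} (M N : Matrix ι κ ℝ) : const (M + N) = const M + const N := by
  ext i j
  simp

lemma const_sub {ι κ : Type*} (M N : Matrix ι κ ℝ) : const (M - N) = const M - const N := by
  ext i j
  simp

lemma const_transpose {ι κ : Type*} (M : Matrix ι κ ℝ) :
    const M.transpose = (const M).transpose := rfl

lemma const_injective {ι κ : Type*} : Function.Injective (const : Matrix ι κ ℝ → _) :=
  Matrix.map_injective Polynomial.C_injective

lemma charmatrix_eq {ι : Type*} [Fintype ι] [DecidableEq ι] (A : Matrix ι ι ℝ) :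
    A.charmatrix = (X : ℝ[X]) • (1 : Matrix ι ι ℝ[X]) - const A := by
  ext i j
  simp [Matrix.charmatrix_apply, Matrix.one_apply, Matrix.diagonal_apply]

lemma act_charmatrix {V ι : Type*} [Fintype ι] [DecidableEq ι] [AddCommGroup V] [Module ℝ[X] V]
    (A : Matrix ι ι ℝ) (w : ι → V) :
    act A.charmatrix w = (X : ℝ[X]) • w - act (const A) w := by
  rw [charmatrix_eq, act_sub, act_smul_one]

/-! ### Weak solutions in terms of distributions -/

/-- A polynomial function, as a locally integrable one. -/
def polyFun (p : ℝ[X]) : LocInt := ofCont (fun t => p.eval t) p.continuous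

@[simp] lemma coe_polyFun (p : ℝ[X]) : (polyFun p : ℝ → ℝ) = fun t => p.eval t := rfl

lemma X_smul_toDistr_polyFun (p : ℝ[X]) :
    (X : ℝ[X]) • toDistr (polyFun p) = toDistr (polyFun (derivative p)) :=
  X_smul_toDistr_of_hasDerivAt (derivative p).continuous (fun t => p.hasDerivAt t) p.continuous

lemma exists_derivative_eq (p : ℝ[X]) {L : ℕ} (hp : p.degree < L) :
    ∃ q : ℝ[X], derivative q = p ∧ q.degree < (L + 1 : ℕ) := by
  refine ⟨∑ k ∈ Finset.range L, C (p.coeff k / (k + 1)) * X ^ (k + 1), ?_, ?_⟩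
  · conv_rhs => rw [p.as_sum_range_C_mul_X_pow' (n := L + 1)
      (Nat.lt_succ_of_le (natDegree_le_of_degree_le hp.le)), Finset.sum_range_succ,
      coeff_eq_zero_of_degree_lt hp, map_zero, zero_mul, add_zero]
    rw [derivative_sum]
    refine Finset.sum_congr rfl fun k _ => ?_
    rw [derivative_C_mul_X_pow]
    have : ((k : ℝ) + 1) ≠ 0 := by positivity
    push_cast
    rw [div_mul_cancel₀ _ this]
  · rw [degree_lt_iff_coeff_zero]
    intro m hm
    rw [finsetSum_coeff]
    refine Finset.sum_eq_zero fun k hk => ?_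
    rw [coeff_C_mul_X_pow, if_neg]
    have := Finset.mem_range.1 hk
    omega

/-- The only distributions with zero `L`-th derivative are the polynomials of degree less than
`L`. -/
lemma X_pow_smul_eq_zero_iff (L : ℕ) (w : Distr) :
    (X ^ L : ℝ[X]) • w = 0 ↔ ∃ p : ℝ[X], p.degree < L ∧ w = toDistr (polyFun p) := by
  induction L generalizing w with
  | zero =>
    have h0 : toDistr (polyFun 0) = 0 := by
      have : polyFun 0 = 0 := by ext t; simp
      rw [this, map_zero]
    simp only [pow_zero, one_smul, Nat.cast_zero]
    constructor
    · rintro rfl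
      exact ⟨0, by simp, h0.symm⟩
    · rintro ⟨p, hp, rfl⟩
      rw [degree_eq_bot.1 (Nat.WithBot.lt_zero_iff.1 hp), h0]
  | succ L ih =>
    rw [pow_succ, mul_smul, ih]
    constructor
    · rintro ⟨p, hp, h⟩
      obtain ⟨q, rfl, hq⟩ := exists_derivative_eq p hp
      rw [← X_smul_toDistr_polyFun, ← sub_eq_zero, ← smul_sub] at h
      obtain ⟨c, hc⟩ := exists_eq_const_of_X_smul_eq_zero h
      refine ⟨q + C c, ?_, ?_⟩
      · refine (degree_add_le _ _).trans_lt (max_lt hq (degree_C_le.trans_lt ?_))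
        exact_mod_cast Nat.succ_pos L
      · rw [sub_eq_iff_eq_add'] at hc
        rw [hc, oneDistr, ← map_smul, ← map_add]
        congr 1
        ext t
        simp
    · rintro ⟨p, hp, rfl⟩
      refine ⟨derivative p, ?_, X_smul_toDistr_polyFun p⟩
      by_cases h0 : p = 0
      · simp [h0]
      · refine lt_of_lt_of_le (degree_derivative_lt h0) ?_
        exact Order.le_of_lt_succ (by exact_mod_cast hp)

lemma natDegree_le_matDegree {ι κ : Type*} [Fintype ι] [Fintype κ] (R : Matrix ι κ ℝ[X])
    (i : ι) (j : κ) : (R i j).natDegree ≤ matDegree R :=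
  (Finset.le_sup (f := fun j => (R i j).natDegree) (Finset.mem_univ j)).trans
    (Finset.le_sup (f := fun i => Finset.univ.sup fun j => (R i j).natDegree)
      (Finset.mem_univ i))

/-- Weak solutions are the solutions in the sense of distributions: the `L`-fold integrated
equation says that the `L`-th derivative of a locally integrable function is zero. -/
lemma isWeakSolution_iff {ι κ : Type*} [Fintype ι] [Fintype κ] (R : Matrix ι κ ℝ[X])
    (f : κ → LocInt) :
    IsWeakSolution R (fun t j => (f j : ℝ → ℝ) t) ↔ act R (fun j => toDistr (f j)) = 0 := by
  set L := matDegree R with hL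
  let F : ι → LocInt := fun i =>
    ∑ j, ∑ k ∈ Finset.range (L + 1), (R i j).coeff k • (primitive ^ (L - k)) (f j)
  have hF : ∀ i, act R (fun j => toDistr (f j)) i = (X ^ L : ℝ[X]) • toDistr (F i) := by
    intro i
    simp only [act, F, map_sum, Finset.smul_sum, map_smul]
    refine Finset.sum_congr rfl fun j _ => ?_
    conv_lhs => rw [(R i j).as_sum_range_C_mul_X_pow' (n := L + 1)
      (Nat.lt_succ_of_le (natDegree_le_matDegree R i j)), Finset.sum_smul]
    refine Finset.sum_congr rfl fun k hk => ?_
    have hk' : L = k + (L - k) := by have := Finset.mem_range.1 hk; omega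
    rw [smul_comm, mul_smul, Distr.C_smul]
    congr 1
    conv_rhs => rw [hk', pow_add, mul_smul, Nat.add_sub_cancel_left,
      X_pow_smul_toDistr_primitive_pow]
  have hFt : ∀ i t, (F i : ℝ → ℝ) t = ∑ j, ∑ k ∈ Finset.range (L + 1),
      (R i j).coeff k * (integ^[L - k] fun s => (f j : ℝ → ℝ) s) t := by
    intro i t
    simp only [F, Submodule.coe_sum, Finset.sum_apply, Submodule.coe_smul, Pi.smul_apply,
      coe_primitive_pow, smul_eq_mul]
  have key : act R (fun j => toDistr (f j)) = 0 ↔ ∀ i, ∃ p : ℝ[X], p.degree < (L : WithBot ℕ) ∧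
      ∀ᵐ t : ℝ, (F i : ℝ → ℝ) t = p.eval t := by
    rw [funext_iff]
    refine forall_congr' fun i => ?_
    rw [hF, Pi.zero_apply, X_pow_smul_eq_zero_iff]
    refine exists_congr fun p => and_congr_right fun _ => ?_
    rw [toDistr_eq_iff]
    rfl
  rw [key, Classical.skolem]
  simp only [IsWeakSolution, ← hL, ← hFt, ae_all_iff, forall_and]

/-! ### Division of polynomial matrices by a characteristic matrix -/

section Division

variable {ι κ : Type*} [Fintype ι] [DecidableEq ι]

lemma charmatrix_mul (A : Matrix ι ι ℝ) (W : Matrix ι κ ℝ[X]) :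
    A.charmatrix * W = (X : ℝ[X]) • W - const A * W := by
  rw [charmatrix_eq, Matrix.sub_mul, Matrix.smul_mul, Matrix.one_mul]

lemma mul_charmatrix (A : Matrix ι ι ℝ) (W : Matrix κ ι ℝ[X]) :
    W * A.charmatrix = (X : ℝ[X]) • W - W * const A := by
  rw [charmatrix_eq, Matrix.mul_sub, Matrix.mul_smul, Matrix.mul_one]

variable [Fintype κ]

/-- Division with remainder by `ξ I - A` on the left. -/
lemma exists_eq_charmatrix_mul_add (A : Matrix ι ι ℝ) (W : Matrix ι κ ℝ[X]) :
    ∃ (H : Matrix ι κ ℝ[X]) (B : Matrix ι κ ℝ), W = A.charmatrix * H + const B := by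
  have hX : ∀ W : Matrix ι κ ℝ[X],
      (∃ (H : Matrix ι κ ℝ[X]) (B : Matrix ι κ ℝ), W = A.charmatrix * H + const B) →
      ∃ (H : Matrix ι κ ℝ[X]) (B : Matrix ι κ ℝ),
        (X : ℝ[X]) • W = A.charmatrix * H + const B := by
    rintro W ⟨H, B, rfl⟩
    refine ⟨(X : ℝ[X]) • H + const B, A * B, ?_⟩
    rw [const_mul, Matrix.mul_add, charmatrix_mul A (const B), smul_add, Matrix.mul_smul]
    abel
  -- Induction on a bound for the degrees of the entries, splitting off constant terms.
  suffices h : ∀ (m : ℕ) (W : Matrix ι κ ℝ[X]), (∀ i j, (W i j).natDegree ≤ m) →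
      ∃ (H : Matrix ι κ ℝ[X]) (B : Matrix ι κ ℝ), W = A.charmatrix * H + const B from
    h _ W (natDegree_le_matDegree W)
  intro m
  induction m with
  | zero =>
    intro W hW
    refine ⟨0, W.map fun p => p.coeff 0, ?_⟩
    ext1 i j
    rw [eq_C_of_natDegree_le_zero (hW i j)]
    simp
  | succ m ih =>
    intro W hW
    obtain ⟨H, B, h⟩ := hX (W.map divX) (ih _ fun i j => by
      have := hW i j
      rw [Matrix.map_apply, natDegree_divX_eq_natDegree_tsub_one]
      omega)
    refine ⟨H, B + W.map fun p => p.coeff 0, ?_⟩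
    rw [const_add, ← add_assoc, ← h]
    ext1 i j
    simp [X_mul_divX_add]

/-- Multiplication by `ξ I - A` raises the degree by one. -/
lemma coeff_eq_zero_of_coeff_charmatrix_mul {A : Matrix ι ι ℝ} {H : Matrix ι κ ℝ[X]} {N : ℕ}
    (h : ∀ i j m, N < m → ((A.charmatrix * H) i j).coeff m = 0) (i : ι) (j : κ) {m : ℕ}
    (hm : N ≤ m) : (H i j).coeff m = 0 := by
  have hcoeff : ∀ (m : ℕ), N ≤ m → ∀ (i : ι) (j : κ),
      (H i j).coeff m = ∑ k, A i k * (H k j).coeff (m + 1) := by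
    intro m hm i j
    have h1 := h i j (m + 1) (Nat.lt_succ_of_le hm)
    rw [charmatrix_mul] at h1
    simp only [Matrix.sub_apply, Matrix.smul_apply, smul_eq_mul, coeff_sub, coeff_X_mul,
      Matrix.mul_apply, finsetSum_coeff, Matrix.map_apply, coeff_C_mul] at h1
    linarith
  have : ∀ (l m : ℕ), N ≤ m → (∀ i j, (H i j).natDegree < m + l) →
      ∀ i j, (H i j).coeff m = 0 := by
    intro l
    induction l with
    | zero => exact fun m _ hm i j => coeff_eq_zero_of_natDegree_lt (hm i j)
    | succ l ih =>
      intro m hm hm' i j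
      rw [hcoeff m hm]
      refine Finset.sum_eq_zero fun k _ => ?_
      have := ih (m + 1) (by omega) (fun i j => by have := hm' i j; omega) k j
      rw [this, mul_zero]
  exact this (matDegree H + 1) m hm (fun i j => by
    have := natDegree_le_matDegree H i j
    omega) i j

/-- A constant matrix divisible by `ξ I - A` on the left is zero, with zero quotient. -/
lemma eq_zero_of_charmatrix_mul_eq_const {A : Matrix ι ι ℝ} {H : Matrix ι κ ℝ[X]}
    {B : Matrix ι κ ℝ} (h : A.charmatrix * H = const B) : H = 0 ∧ B = 0 := by
  have hH : H = 0 := by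
    ext i j m
    refine coeff_eq_zero_of_coeff_charmatrix_mul (N := 0) (A := A) (fun i j m hm => ?_) i j
      (Nat.zero_le m)
    rw [h]
    exact coeff_C_of_ne_zero hm.ne'
  refine ⟨hH, const_injective ?_⟩
  rw [← h, hH]
  ext
  simp

lemma degree_adjugate_charmatrix_lt (A : Matrix ι ι ℝ) (i j : ι) :
    (A.charmatrix.adjugate i j).degree < (Fintype.card ι : ℕ) := by
  rw [degree_lt_iff_coeff_zero]
  intro m hm
  refine coeff_eq_zero_of_coeff_charmatrix_mul (A := A) (fun i j m hm => ?_) i j hm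
  rw [Matrix.mul_adjugate]
  rw [← Matrix.charpoly, Matrix.smul_apply, Matrix.one_apply]
  split_ifs
  · rw [smul_eq_mul, mul_one]
    exact coeff_eq_zero_of_natDegree_lt (by rwa [Matrix.charpoly_natDegree_eq_dim])
  · simp

end Division

/-! ### A state map for a nonsingular polynomial matrix -/

lemma finite_quotient_of_det_ne_zero {n : ℕ} {Q : Matrix (Fin n) (Fin n) ℝ[X]}
    (hQ : Q.det ≠ 0) :
    Module.Finite ℝ ((Fin n → ℝ[X]) ⧸ LinearMap.range Q.vecMulLinear) := by
  set p : ℝ[X] := Q.det * C Q.det.leadingCoeff⁻¹ with hp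
  have hmonic : p.Monic := monic_mul_leadingCoeff_inv hQ
  have hmem : ∀ v : Fin n → ℝ[X], p • v ∈ LinearMap.range Q.vecMulLinear := by
    intro v
    refine ⟨Matrix.vecMul (C Q.det.leadingCoeff⁻¹ • v) Q.adjugate, ?_⟩
    rw [Matrix.vecMulLinear_apply, Matrix.vecMul_vecMul, Matrix.adjugate_mul, Matrix.vecMul_smul,
      Matrix.vecMul_one, smul_smul, hp]
  let F : (Fin n → degreeLT ℝ p.natDegree) →ₗ[ℝ]
      ((Fin n → ℝ[X]) ⧸ LinearMap.range Q.vecMulLinear) :=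
    ((LinearMap.range Q.vecMulLinear).mkQ.restrictScalars ℝ) ∘ₗ
      LinearMap.pi fun i => (degreeLT ℝ p.natDegree).subtype ∘ₗ LinearMap.proj i
  refine Module.Finite.of_surjective F fun x => ?_
  obtain ⟨v, rfl⟩ := Submodule.mkQ_surjective _ x
  refine ⟨fun i => ⟨v i %ₘ p, ?_⟩, ?_⟩
  · rw [mem_degreeLT, ← degree_eq_natDegree hmonic.ne_zero]
    exact degree_modByMonic_lt _ hmonic
  · refine (Submodule.Quotient.eq _).2 ?_
    convert hmem (fun i => - (v i /ₘ p)) using 1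
    ext1 i
    have := modByMonic_add_div (v i) p
    change v i %ₘ p - v i = p * _
    linear_combination this

/-- A state space for a polynomial matrix `Q`.  The rows of `r` represent a basis of the module
of polynomial row vectors modulo the rows of `Q`; `A` is multiplication by `ξ` on that
module, and the rows of `C` are the coordinates of the unit vectors. -/
structure StateMap {n : ℕ} (Q : Matrix (Fin n) (Fin n) ℝ[X]) (d : ℕ) where
  A : Matrix (Fin d) (Fin d) ℝ
  C : Matrix (Fin n) (Fin d) ℝ
  r : Matrix (Fin d) (Fin n) ℝ[X]
  q : Matrix (Fin d) (Fin n) ℝ[X]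
  s : Matrix (Fin n) (Fin n) ℝ[X]
  K : Matrix (Fin n) (Fin d) ℝ[X]
  charmatrix_mul_r : A.charmatrix * r = q * Q
  const_C_mul_r : const C * r = 1 - s * Q
  mul_const_C : Q * const C = K * A.charmatrix
  K_mul_q : K * q = 1 - Q * s

lemma mul_right_cancel_of_det_ne_zero {ι : Type*} {n : ℕ} {Q : Matrix (Fin n) (Fin n) ℝ[X]}
    (hQ : Q.det ≠ 0) {M N : Matrix ι (Fin n) ℝ[X]} (h : M * Q = N * Q) : M = N := by
  have := congrArg (fun Z => Z * Q.adjugate) h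
  simp only [Matrix.mul_assoc, Matrix.mul_adjugate, Matrix.mul_smul, Matrix.mul_one] at this
  ext1 i j
  have := congrFun (congrFun this i) j
  exact mul_left_cancel₀ hQ this

lemma mul_left_cancel_of_det_ne_zero {ι : Type*} {n : ℕ} {Q : Matrix (Fin n) (Fin n) ℝ[X]}
    (hQ : Q.det ≠ 0) {M N : Matrix (Fin n) ι ℝ[X]} (h : Q * M = Q * N) : M = N := by
  have := congrArg (fun Z => Q.adjugate * Z) h
  simp only [← Matrix.mul_assoc, Matrix.adjugate_mul, Matrix.smul_mul, Matrix.one_mul] at this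
  ext1 i j
  have := congrFun (congrFun this i) j
  exact mul_left_cancel₀ hQ this

/-- The module of row vectors modulo the rows of `Q` is finite-dimensional, and a basis of it gives
a state map. -/
lemma exists_stateMap {n : ℕ} {Q : Matrix (Fin n) (Fin n) ℝ[X]} (hQ : Q.det ≠ 0) :
    ∃ d, Nonempty (StateMap Q d) := by
  set N : Submodule ℝ[X] (Fin n → ℝ[X]) := LinearMap.range Q.vecMulLinear with hN
  have : Module.Finite ℝ ((Fin n → ℝ[X]) ⧸ N) := finite_quotient_of_det_ne_zero hQ
  let b := Module.finBasis ℝ ((Fin n → ℝ[X]) ⧸ N)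
  set d := Module.finrank ℝ ((Fin n → ℝ[X]) ⧸ N)
  refine ⟨d, ?_⟩
  choose r hr using fun i : Fin d => N.mkQ_surjective (b i)
  -- Coordinates with respect to `b` lift to congruences modulo the rows of `Q`.
  have hlift : ∀ v : Fin n → ℝ[X], ∃ (c : Fin d → ℝ) (w : Fin n → ℝ[X]),
      v = (∑ j, Polynomial.C (c j) • r j) + Matrix.vecMul w Q := by
    intro v
    have hv : v - ∑ j, Polynomial.C (b.repr (N.mkQ v) j) • r j ∈ N := by
      refine (Submodule.Quotient.mk_eq_zero N).1 ?_
      rw [← Submodule.mkQ_apply, map_sub, map_sum, sub_eq_zero]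
      conv_lhs => rw [← b.sum_repr (N.mkQ v)]
      refine Finset.sum_congr rfl fun j _ => ?_
      rw [map_smul, hr, ← algebraMap_eq, algebraMap_smul]
    obtain ⟨w, hw⟩ := hv
    exact ⟨_, w, by rw [← Matrix.vecMulLinear_apply, hw]; abel⟩
  choose A q hA using fun i : Fin d => hlift ((X : ℝ[X]) • r i)
  choose C s hC using fun i : Fin n => hlift (Pi.single i 1)
  have hsum : ∀ {κ : Type} (c : κ → Fin d → ℝ) (i : κ),
      (∑ j, Polynomial.C (c i j) • r j) = (const (Matrix.of c) * Matrix.of r) i := by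
    intro κ c i
    ext1 k
    simp [Matrix.mul_apply]
  have h1 : (Matrix.of A).charmatrix * Matrix.of r = Matrix.of q * Q := by
    rw [charmatrix_mul]
    funext i
    have := hA i
    rw [hsum] at this
    change (X : ℝ[X]) • r i - _ = _
    rw [this, add_sub_cancel_left]
    rfl
  have h2 : const (Matrix.of C) * Matrix.of r = 1 - Matrix.of s * Q := by
    funext i
    have := hC i
    rw [hsum] at this
    have e : (1 : Matrix (Fin n) (Fin n) ℝ[X]) i = Pi.single i 1 := by
      ext1 j
      rw [Matrix.one_apply, Pi.single_apply]
      simp only [eq_comm]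
    change _ = (1 : Matrix (Fin n) (Fin n) ℝ[X]) i - _
    rw [e, this]
    exact (add_sub_cancel_right _ _).symm
  obtain ⟨H, B, hH⟩ := exists_eq_charmatrix_mul_add (Matrix.of A).transpose
    (Q * const (Matrix.of C)).transpose
  have h3 : Q * const (Matrix.of C) =
      H.transpose * (Matrix.of A).charmatrix + const B.transpose := by
    have := congrArg Matrix.transpose hH
    rwa [Matrix.transpose_transpose, Matrix.transpose_add, Matrix.transpose_mul,
      Matrix.charmatrix_transpose, Matrix.transpose_transpose, ← const_transpose] at this
  have h4 : const B.transpose * Matrix.of r =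
      (1 - Q * Matrix.of s - H.transpose * Matrix.of q) * Q := by
    have := congrArg (fun Z => Z * Matrix.of r) h3
    simp only [Matrix.add_mul, Matrix.mul_assoc] at this
    rw [h1, h2] at this
    rw [Matrix.sub_mul, Matrix.sub_mul, Matrix.one_mul, Matrix.mul_assoc, Matrix.mul_assoc]
    rw [Matrix.mul_sub, Matrix.mul_one] at this
    rw [this]
    abel
  -- The remainder is zero because the rows of `r` are linearly independent modulo `N`.
  have hB : B.transpose = 0 := by
    ext i j
    have hmem : ∑ j, Polynomial.C (B.transpose i j) • r j ∈ N := by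
      obtain ⟨W, hW⟩ : ∃ W, const B.transpose * Matrix.of r = W * Q := ⟨_, h4⟩
      have hW' := congrFun hW i
      rw [Matrix.mul_apply_eq_vecMul W Q i] at hW'
      have := (hsum B.transpose i).trans hW'
      rw [this]
      exact LinearMap.mem_range_self Q.vecMulLinear (W i)
    replace hmem := (Submodule.Quotient.mk_eq_zero N).2 hmem
    rw [← Submodule.mkQ_apply, map_sum] at hmem
    have : ∑ j, B.transpose i j • b j = 0 := by
      rw [← hmem]
      refine Finset.sum_congr rfl fun j _ => ?_
      rw [map_smul, hr, ← algebraMap_eq, algebraMap_smul]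
    exact Fintype.linearIndependent_iff.1 b.linearIndependent _ this j
  refine ⟨⟨Matrix.of A, Matrix.of C, Matrix.of r, Matrix.of q, Matrix.of s, H.transpose,
    h1, h2, ?_, ?_⟩⟩
  · rw [h3, hB]
    simp
  · rw [hB] at h4
    have h5 : (1 - Q * Matrix.of s - H.transpose * Matrix.of q) * Q = 0 * Q := by
      rw [← h4]
      simp
    have := mul_right_cancel_of_det_ne_zero hQ h5
    rw [sub_eq_zero] at this
    exact this.symm

/-! ### Realization of a proper transfer matrix -/

/-- A state-space realization of `P(d/dt) u = Q(d/dt) y`: a state map for `Q`, together with the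
quotient `H` and remainder `B` of `q P` by `ξ I - A`, and the feedthrough matrix `D`. -/
structure Realization {n : ℕ} (P Q : Matrix (Fin n) (Fin n) ℝ[X]) (d : ℕ) extends
    StateMap Q d where
  B : Matrix (Fin d) (Fin n) ℝ
  D : Matrix (Fin n) (Fin n) ℝ
  H : Matrix (Fin d) (Fin n) ℝ[X]
  q_mul_P : q * P = A.charmatrix * H + const B
  const_D : const D = const C * H + s * P

lemma StateMap.K_mul_const_add {n d : ℕ} {P Q : Matrix (Fin n) (Fin n) ℝ[X]} (S : StateMap Q d)
    {H : Matrix (Fin d) (Fin n) ℝ[X]} {B : Matrix (Fin d) (Fin n) ℝ}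
    (h : S.q * P = S.A.charmatrix * H + const B) :
    S.K * const B + Q * (const S.C * H + S.s * P) = P := by
  have h1 := congrArg (fun Z => S.K * Z) h
  simp only [Matrix.mul_add, ← Matrix.mul_assoc, S.K_mul_q, ← S.mul_const_C] at h1
  rw [Matrix.sub_mul, Matrix.one_mul] at h1
  rw [Matrix.mul_add, ← Matrix.mul_assoc, ← Matrix.mul_assoc]
  rw [sub_eq_iff_eq_add] at h1
  conv_rhs => rw [h1]
  abel

/-- If a proper rational function is the sum of a polynomial `p` and a strictly proper fraction
`E / χ`, then `p` is constant. -/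
lemma degree_le_zero_of_isProperRat {g : RatFunc ℝ} (hg : IsProperRat g) {χ E p : ℝ[X]}
    (hχ : χ ≠ 0) (hE : E.degree < χ.degree)
    (h : algebraMap ℝ[X] (RatFunc ℝ) χ * g = algebraMap ℝ[X] (RatFunc ℝ) (E + χ * p)) :
    p.degree ≤ 0 := by
  by_contra! hp
  have hden : algebraMap ℝ[X] (RatFunc ℝ) g.denom ≠ 0 :=
    RatFunc.algebraMap_ne_zero g.denom_ne_zero
  rw [← RatFunc.num_div_denom g, mul_div_assoc', div_eq_iff hden, ← map_mul, ← map_mul] at h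
  have h' := congrArg degree (RatFunc.algebraMap_injective ℝ h)
  have hlt : E.degree < (χ * p).degree := by
    rw [degree_mul]
    refine hE.trans_le ?_
    rw [degree_eq_natDegree hχ] at *
    rw [degree_eq_natDegree (fun h0 => by simp [h0] at hp)]
    exact_mod_cast Nat.le_add_right _ _
  have hp0 : p ≠ 0 := by
    rintro rfl
    simp at hp
  rw [degree_mul, degree_mul, degree_add_eq_right_of_degree_lt hlt, degree_mul] at h'
  have hle : χ.degree + g.num.degree ≤ χ.degree + g.denom.degree := by
    gcongr
    exact hg
  rw [h'] at hle
  rw [degree_eq_natDegree hχ, degree_eq_natDegree hp0, degree_eq_natDegree g.denom_ne_zero] at hle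
  rw [degree_eq_natDegree hp0] at hp
  have h1 : χ.natDegree + p.natDegree + g.denom.natDegree ≤ χ.natDegree + g.denom.natDegree := by
    exact_mod_cast hle
  have h2 : 0 < p.natDegree := by exact_mod_cast hp
  omega

lemma degree_const_mul_adjugate_mul_const_lt {n d : ℕ} (A : Matrix (Fin d) (Fin d) ℝ)
    (C : Matrix (Fin n) (Fin d) ℝ) (B : Matrix (Fin d) (Fin n) ℝ) (i j : Fin n) :
    ((const C * A.charmatrix.adjugate * const B) i j).degree < A.charpoly.degree := by
  rw [degree_eq_natDegree A.charpoly_monic.ne_zero, Matrix.charpoly_natDegree_eq_dim,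
    degree_lt_iff_coeff_zero]
  intro m hm
  have hadj : ∀ i j, (A.charmatrix.adjugate i j).coeff m = 0 := fun i j =>
    (degree_lt_iff_coeff_zero _ _).1 (degree_adjugate_charmatrix_lt A i j) m hm
  simp only [Matrix.mul_apply, finsetSum_coeff, Matrix.map_apply, coeff_mul_C, coeff_C_mul, hadj,
    mul_zero, zero_mul, Finset.sum_const_zero]

/-- A state map for `Q` extends to a realization: the matrix `C H + s P` is the polynomial part of
`Q⁻¹ P`, hence constant if `Q⁻¹ P` is proper. -/
lemma exists_realization {n : ℕ} {P Q : Matrix (Fin n) (Fin n) ℝ[X]} (hQ : Q.det ≠ 0)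
    (hproper : ∀ i j, IsProperRat (transferMatrix P Q i j)) :
    ∃ d, Nonempty (Realization P Q d) := by
  obtain ⟨d, ⟨S⟩⟩ := exists_stateMap hQ
  obtain ⟨H, B, hB⟩ := exists_eq_charmatrix_mul_add S.A (S.q * P)
  set D' := const S.C * H + S.s * P with hD'
  have hP : S.K * const B + Q * D' = P := S.K_mul_const_add hB
  set χ := S.A.charpoly with hχ
  set E := const S.C * S.A.charmatrix.adjugate * const B with hE
  have h1 : Q * (E + χ • D') = χ • P := by
    rw [Matrix.mul_add, hE, ← Matrix.mul_assoc, ← Matrix.mul_assoc, S.mul_const_C,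
      Matrix.mul_assoc S.K, Matrix.mul_adjugate, ← Matrix.charpoly, Matrix.mul_smul,
      Matrix.mul_one, Matrix.smul_mul, Matrix.mul_smul, ← smul_add, hP]
  let φ : ℝ[X] →+* RatFunc ℝ := algebraMap ℝ[X] (RatFunc ℝ)
  have hdet : IsUnit (Q.map φ).det := by
    rw [← RingHom.mapMatrix_apply, ← RingHom.map_det]
    exact (RatFunc.algebraMap_ne_zero hQ).isUnit
  have h2 : ∀ i j, φ χ * transferMatrix P Q i j = φ (E i j + χ * D' i j) := by
    have e : φ χ • transferMatrix P Q = (E + χ • D').map φ := by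
      have := congrArg (fun Z => (Q.map φ)⁻¹ * Matrix.map Z φ) h1
      simp only [Matrix.map_mul, ← Matrix.mul_assoc, Matrix.nonsing_inv_mul _ hdet,
        Matrix.one_mul] at this
      rw [this, transferMatrix, ← Matrix.mul_smul]
      congr 1
      ext1 i j
      simp [φ]
    intro i j
    have := congrFun (congrFun e i) j
    simpa using this
  have hdeg : ∀ i j, (D' i j).degree ≤ 0 := by
    intro i j
    refine degree_le_zero_of_isProperRat (hproper i j) S.A.charpoly_monic.ne_zero ?_ (h2 i j)
    exact degree_const_mul_adjugate_mul_const_lt S.A S.C B i j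
  refine ⟨d, ⟨⟨S, B, D'.map fun p => p.coeff 0, H, hB, ?_⟩⟩⟩
  rw [← hD']
  ext1 i j
  exact (eq_C_of_degree_le_zero (hdeg i j)).symm

/-- A remainder `Φ` on division by `ξ I - A` of a matrix `Zᵀ` with `Zᵀ (ξ I - A)ᵀ = (ξ I - A) Z`
is symmetric, and intertwines `A` and its transpose. -/
lemma intertwines_of_divisible {ι : Type*} [Fintype ι] [DecidableEq ι] {A Φ : Matrix ι ι ℝ}
    {Z G : Matrix ι ι ℝ[X]}
    (hY : Z.transpose * A.charmatrix.transpose = A.charmatrix * Z)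
    (hG : Z.transpose = A.charmatrix * G + const Φ) :
    A * Φ = Φ * A.transpose ∧ Φ.transpose = Φ := by
  rw [hG, Matrix.add_mul, Matrix.mul_assoc] at hY
  have e1 : A.charmatrix * (Z - G * A.charmatrix.transpose - const Φ) =
      const (A * Φ - Φ * A.transpose) := by
    have e0 : const Φ * A.charmatrix.transpose =
        (X : ℝ[X]) • const Φ - const (Φ * A.transpose) := by
      rw [← Matrix.charmatrix_transpose, mul_charmatrix A.transpose (const Φ), const_mul]
    rw [Matrix.mul_sub, Matrix.mul_sub, ← hY, const_sub, const_mul A,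
      charmatrix_mul A (const Φ), e0]
    abel
  obtain ⟨h0, h1⟩ := eq_zero_of_charmatrix_mul_eq_const e1
  refine ⟨sub_eq_zero.1 h1, ?_⟩
  have e2 := congrArg Matrix.transpose (sub_eq_zero.1 h0)
  rw [Matrix.transpose_sub, Matrix.transpose_mul, Matrix.transpose_transpose, hG,
    ← const_transpose] at e2
  have e3 : A.charmatrix * (G - G.transpose) = const (Φ.transpose - Φ) := by
    rw [Matrix.mul_sub, const_sub, ← e2]
    abel
  exact sub_eq_zero.1 (eq_zero_of_charmatrix_mul_eq_const e3).2

namespace Realization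

variable {n d : ℕ} {P Q : Matrix (Fin n) (Fin n) ℝ[X]} (S : Realization P Q d)

lemma K_mul_B_add : S.K * const S.B + Q * const S.D = P := by
  rw [S.const_D]
  exact S.K_mul_const_add S.q_mul_P

/-- Eliminating the state: every external trajectory of the realization satisfies
`P(d/dt) u = Q(d/dt) y`. -/
lemma act_eq_of_state {V : Type*} [AddCommGroup V] [Module ℝ[X] V] {u y : Fin n → V}
    {x : Fin d → V} (hx : (X : ℝ[X]) • x = act (const S.A) x + act (const S.B) u)
    (hy : y = act (const S.C) x + act (const S.D) u) : act P u = act Q y := by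
  have h1 : act S.A.charmatrix x = act (const S.B) u := by
    rw [act_charmatrix, hx, add_sub_cancel_left]
  rw [hy, act_vadd, ← act_mul, ← act_mul, S.mul_const_C, act_mul, h1, ← act_mul, ← act_add,
    S.K_mul_B_add]

/-- The state of an external trajectory is `r(d/dt) y - H(d/dt) u`. -/
lemma state_of_act_eq {V : Type*} [AddCommGroup V] [Module ℝ[X] V] {u y : Fin n → V}
    (h : act P u = act Q y) :
    (X : ℝ[X]) • (act S.r y - act S.H u) =
      act (const S.A) (act S.r y - act S.H u) + act (const S.B) u ∧
    y = act (const S.C) (act S.r y - act S.H u) + act (const S.D) u := by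
  constructor
  · rw [← sub_eq_iff_eq_add', ← act_charmatrix, act_vsub, ← act_mul, ← act_mul,
      S.charmatrix_mul_r, act_mul, ← h, ← act_mul, S.q_mul_P, act_add]
    abel
  · rw [act_vsub, ← act_mul, ← act_mul, S.const_C_mul_r, act_sub, act_one, act_mul, ← h,
      ← act_mul, S.const_D, act_add]
    abel

/-- If `Q⁻¹ P` is symmetric, then the realization is intertwined with its dual by a symmetric
matrix `Φ`, the remainder of `q P rᵀ` by `ξ I - A`, and the feedthrough matrix is symmetric. -/
lemma exists_intertwiner (hQ : Q.det ≠ 0) (hsymm : P * Q.transpose = Q * P.transpose) :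
    ∃ Φ : Matrix (Fin d) (Fin d) ℝ, S.A * Φ = Φ * S.A.transpose ∧ Φ * S.C.transpose = S.B ∧
      Φ.transpose = Φ ∧ S.D.transpose = S.D := by
  obtain ⟨⟨A, C, r, q, s, K, hr, hC, hK, hKq⟩, B, D, H, hqP, hD⟩ := S
  dsimp only at *
  have hKB : K * const B + Q * const D = P :=
    K_mul_B_add ⟨⟨A, C, r, q, s, K, hr, hC, hK, hKq⟩, B, D, H, hqP, hD⟩
  obtain ⟨G, Φ, hG⟩ := exists_eq_charmatrix_mul_add A (q * (P * r.transpose))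
  have hr' : r.transpose * A.charmatrix.transpose = Q.transpose * q.transpose := by
    rw [← Matrix.transpose_mul, hr, Matrix.transpose_mul]
  -- `q P Qᵀ qᵀ` is symmetric and divisible by `ξ I - A` on the left and by its transpose on the
  -- right.
  have hY : (r * (P.transpose * q.transpose)).transpose * A.charmatrix.transpose =
      A.charmatrix * (r * (P.transpose * q.transpose)) := by
    simp only [Matrix.transpose_mul, Matrix.transpose_transpose]
    rw [← Matrix.mul_assoc A.charmatrix, hr, Matrix.mul_assoc (q * P), hr',
      Matrix.mul_assoc q, ← Matrix.mul_assoc P, hsymm, Matrix.mul_assoc Q, Matrix.mul_assoc q]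
  obtain ⟨h1, h3⟩ := intertwines_of_divisible hY (by
    rw [← hG]
    simp only [Matrix.transpose_mul, Matrix.transpose_transpose, Matrix.mul_assoc])
  have h2 : Φ * C.transpose = B := by
    have e1 := congrArg (fun Z => Z * const C.transpose) hG
    simp only [Matrix.add_mul] at e1
    have e2 : r.transpose * const C.transpose = 1 - Q.transpose * s.transpose := by
      rw [const_transpose, ← Matrix.transpose_mul, hC, Matrix.transpose_sub, Matrix.transpose_one,
        Matrix.transpose_mul]
    have e3 : q * (P * (Q.transpose * s.transpose)) =
        A.charmatrix * (r * (P.transpose * s.transpose)) := by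
      rw [← Matrix.mul_assoc P, hsymm, Matrix.mul_assoc Q, ← Matrix.mul_assoc q, ← hr,
        Matrix.mul_assoc]
    rw [Matrix.mul_assoc q, Matrix.mul_assoc P, e2, Matrix.mul_sub, Matrix.mul_one,
      Matrix.mul_sub, e3, hqP, Matrix.mul_assoc A.charmatrix] at e1
    have e4 : A.charmatrix * (H - r * (P.transpose * s.transpose) - G * const C.transpose) =
        const (Φ * C.transpose - B) := by
      rw [const_sub, const_mul, Matrix.mul_sub, Matrix.mul_sub, sub_eq_iff_eq_add,
        sub_eq_iff_eq_add]
      rw [sub_eq_iff_eq_add, ← eq_sub_iff_add_eq] at e1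
      rw [e1]
      abel
    exact sub_eq_zero.1 (eq_zero_of_charmatrix_mul_eq_const e4).2
  refine ⟨Φ, h1, h2, h3, ?_⟩
  have hcomm : const Φ * A.charmatrix.transpose = A.charmatrix * const Φ := by
    rw [← Matrix.charmatrix_transpose, mul_charmatrix, charmatrix_mul, ← const_mul, ← const_mul,
      h1]
  have e1 : const B * Q.transpose = A.charmatrix * (const Φ * K.transpose) := by
    rw [← h2, const_mul, Matrix.mul_assoc, const_transpose, ← Matrix.transpose_mul, hK,
      Matrix.transpose_mul, ← Matrix.mul_assoc, hcomm, Matrix.mul_assoc]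
  have e2 : Q * (const D * Q.transpose) =
      P * Q.transpose - K * (A.charmatrix * (const Φ * K.transpose)) := by
    rw [← e1]
    conv_rhs => rw [← hKB]
    rw [Matrix.add_mul, Matrix.mul_assoc, Matrix.mul_assoc, add_sub_cancel_left]
  have e3 : (Q * (const D * Q.transpose)).transpose = Q * (const D * Q.transpose) := by
    rw [e2]
    simp only [Matrix.transpose_sub, Matrix.transpose_mul, Matrix.transpose_transpose]
    rw [← const_transpose, h3, ← hsymm, Matrix.mul_assoc K, Matrix.mul_assoc, hcomm,
      Matrix.mul_assoc]
  simp only [Matrix.transpose_mul, Matrix.transpose_transpose] at e3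
  rw [Matrix.mul_assoc, ← const_transpose] at e3
  have hQt : Q.transpose.det ≠ 0 := by rwa [Matrix.det_transpose]
  exact const_injective
    (mul_right_cancel_of_det_ne_zero hQt (mul_left_cancel_of_det_ne_zero hQ e3))

end Realization

/-! ### Behaviors as solution sets in distributions -/

lemma locallyIntegrable_pi_iff {κ : Type*} [Fintype κ] {w : ℝ → κ → ℝ} :
    LocallyIntegrable w ↔ ∀ j, LocallyIntegrable fun t => w t j := by
  simp only [locallyIntegrable_iff, IntegrableOn, integrable_pi_iff]
  tauto

/-- The vector-valued function with given locally integrable components. -/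
def vecFun {κ : Type*} (F : κ → LocInt) : ℝ → κ → ℝ := fun t j => (F j : ℝ → ℝ) t

/-- The vector of distributions with given locally integrable components. -/
def vecDistr {κ : Type*} (F : κ → LocInt) : κ → Distr := fun j => toDistr (F j)

lemma locallyIntegrable_vecFun {κ : Type*} [Fintype κ] (F : κ → LocInt) :
    LocallyIntegrable (vecFun F) :=
  locallyIntegrable_pi_iff.2 fun j => (F j).2

lemma exists_vecFun_eq {κ : Type*} [Fintype κ] {w : ℝ → κ → ℝ} (hw : LocallyIntegrable w) :
    ∃ F : κ → LocInt, vecFun F = w :=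
  ⟨fun j => ⟨fun t => w t j, locallyIntegrable_pi_iff.1 hw j⟩, rfl⟩

lemma vecDistr_add {κ : Type*} (F G : κ → LocInt) :
    vecDistr (F + G) = vecDistr F + vecDistr G :=
  funext fun j => map_add toDistr (F j) (G j)

lemma vecDistr_sub {κ : Type*} (F G : κ → LocInt) :
    vecDistr (F - G) = vecDistr F - vecDistr G :=
  funext fun j => map_sub toDistr (F j) (G j)

/-- A real matrix acting on a vector of locally integrable functions. -/
def matFun {ι κ : Type*} [Fintype κ] (M : Matrix ι κ ℝ) (F : κ → LocInt) : ι → LocInt :=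
  fun i => ∑ j, M i j • F j

lemma vecDistr_matFun {ι κ : Type*} [Fintype κ] (M : Matrix ι κ ℝ) (F : κ → LocInt) :
    vecDistr (matFun M F) = act (const M) (vecDistr F) := by
  funext i
  simp only [vecDistr, matFun, act, map_sum, map_smul, Matrix.map_apply, Distr.C_smul]

lemma vecFun_matFun {ι κ : Type*} [Fintype κ] (M : Matrix ι κ ℝ) (F : κ → LocInt) (t : ℝ) :
    vecFun (matFun M F) t = M.mulVec (vecFun F t) := by
  funext i
  simp only [vecFun, matFun, Matrix.mulVec, dotProduct, Submodule.coe_sum, Finset.sum_apply,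
    Submodule.coe_smul, Pi.smul_apply, smul_eq_mul]

lemma vecDistr_eq_iff {κ : Type*} [Fintype κ] (F G : κ → LocInt) :
    vecDistr F = vecDistr G ↔ ∀ᵐ t : ℝ, vecFun F t = vecFun G t := by
  simp only [funext_iff, ae_all_iff, vecDistr, toDistr_eq_iff]
  rfl

lemma mem_ioBehavior_iff {n : ℕ} (P Q : Matrix (Fin n) (Fin n) ℝ[X]) (U Y : Fin n → LocInt) :
    (vecFun U, vecFun Y) ∈ ioBehavior P Q ↔ act P (vecDistr U) = act Q (vecDistr Y) := by
  have h1 : (fun t => Sum.elim (vecFun U t) (vecFun Y t)) =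
      fun t j => ((Sum.elim U Y j : LocInt) : ℝ → ℝ) t := by
    ext t (j | j) <;> rfl
  have h2 : (fun j => toDistr (Sum.elim U Y j)) = Sum.elim (vecDistr U) (vecDistr Y) := by
    ext1 (j | j) <;> rfl
  simp only [ioBehavior, Set.mem_ofPred_eq, locallyIntegrable_vecFun, true_and]
  rw [h1, isWeakSolution_iff, h2, act_fromCols, act_neg, ← sub_eq_add_neg, sub_eq_zero]

lemma mem_externalBehavior_iff {n d : ℕ} (A : Matrix (Fin d) (Fin d) ℝ)
    (B : Matrix (Fin d) (Fin n) ℝ) (C : Matrix (Fin n) (Fin d) ℝ) (D : Matrix (Fin n) (Fin n) ℝ)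
    (U Y : Fin n → LocInt) :
    (vecFun U, vecFun Y) ∈ externalBehavior A B C D ↔ ∃ Z : Fin d → LocInt,
      (X : ℝ[X]) • vecDistr Z = act (const A) (vecDistr Z) + act (const B) (vecDistr U) ∧
      vecDistr Y = act (const C) (vecDistr Z) + act (const D) (vecDistr U) := by
  have key : ∀ Z : Fin d → LocInt, (vecFun U, vecFun Y, vecFun Z) ∈ stateSpaceBehavior A B C D ↔
      (X : ℝ[X]) • vecDistr Z = act (const A) (vecDistr Z) + act (const B) (vecDistr U) ∧
      vecDistr Y = act (const C) (vecDistr Z) + act (const D) (vecDistr U) := by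
    intro Z
    have h1 : (fun t => Sum.elim (vecFun Z t) (vecFun U t)) =
        fun t j => ((Sum.elim Z U j : LocInt) : ℝ → ℝ) t := by
      ext t (j | j) <;> rfl
    have h2 : (fun j => toDistr (Sum.elim Z U j)) = Sum.elim (vecDistr Z) (vecDistr U) := by
      ext1 (j | j) <;> rfl
    simp only [stateSpaceBehavior, Set.mem_ofPred_eq, locallyIntegrable_vecFun, true_and]
    rw [h1, isWeakSolution_iff, h2, act_fromCols, act_neg, act_charmatrix, ← vecDistr_matFun,
      ← vecDistr_matFun, ← vecDistr_matFun, ← vecDistr_matFun, ← vecDistr_add (matFun C Z),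
      vecDistr_eq_iff,
      ← sub_eq_add_neg, sub_sub, sub_eq_zero]
    refine and_congr Iff.rfl (Filter.eventually_congr (Filter.Eventually.of_forall fun t => ?_))
    rw [← vecFun_matFun, ← vecFun_matFun]
    rfl
  constructor
  · rintro ⟨x, hx⟩
    obtain ⟨Z, rfl⟩ := exists_vecFun_eq hx.2.2.1
    exact ⟨Z, (key Z).1 hx⟩
  · rintro ⟨Z, hZ⟩
    exact ⟨vecFun Z, (key Z).2 hZ⟩

/-! ### Linear differential equations with locally integrable forcing -/

/-- The solution of `v' = a v + g` with `v(T) = 0`, for continuous `g`. -/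
lemma exists_hasDerivAt_eq_clm_add {F : Type*} [NormedAddCommGroup F] [NormedSpace ℝ F]
    [CompleteSpace F] (a : F →L[ℝ] F) {g : ℝ → F} (hg : Continuous g) (T : ℝ) :
    ∃ v : ℝ → F, (∀ t, HasDerivAt v (a (v t) + g t) t) ∧
      ((∀ t < T, g t = 0) → ∀ t < T, v t = 0) := by
  let E : ℝ → F →L[ℝ] F := fun t => NormedSpace.exp (t • a)
  have hE : ∀ t, HasDerivAt E (a * E t) t := fun t => hasDerivAt_exp_smul_const' a t
  have hEc : Continuous E := continuous_iff_continuousAt.2 fun t => (hE t).continuousAt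
  have hEE : ∀ t, E t * E (-t) = 1 := by
    intro t
    change NormedSpace.exp (t • a) * NormedSpace.exp (-t • a) = 1
    let : NormedAlgebra ℚ (F →L[ℝ] F) := NormedAlgebra.restrictScalars ℚ ℝ _
    have e : (-t) • a = -(t • a) := neg_smul t a
    rw [e, ← NormedSpace.exp_add_of_commute (Commute.neg_right (Commute.refl _)),
      add_neg_cancel, NormedSpace.exp_zero]
  let h : ℝ → F := fun s => E (-s) (g s)
  have hc : Continuous h := (hEc.comp continuous_neg).clm_apply hg
  have hd : ∀ t, HasDerivAt (fun t => ∫ s in T..t, h s) (h t) t := fun t =>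
    intervalIntegral.integral_hasDerivAt_right (hc.intervalIntegrable _ _)
      (hc.stronglyMeasurableAtFilter _ _) hc.continuousAt
  refine ⟨fun t => E t (∫ s in T..t, h s), fun t => ?_, fun hg0 t ht => ?_⟩
  · refine ((hE t).clm_apply (hd t)).congr_deriv ?_
    have : E t (h t) = g t := by
      change (E t * E (-t)) (g t) = g t
      rw [hEE]
      rfl
    rw [this]
    rfl
  · have : ∫ s in T..t, h s = 0 := by
      rw [intervalIntegral.integral_symm, intervalIntegral.integral_of_le ht.le,
        integral_Ioc_eq_integral_Ioo, setIntegral_eq_zero_of_forall_eq_zero, neg_zero]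
      intro s hs
      change E (-s) (g s) = 0
      rw [hg0 s hs.2, map_zero]
    change E t (∫ s in T..t, h s) = 0
    rw [this, map_zero]

lemma exists_hasDerivAt_eq_mulVec_add {ι : Type*} [Fintype ι] (A : Matrix ι ι ℝ)
    {g : ℝ → ι → ℝ} (hg : Continuous g) (T : ℝ) :
    ∃ v : ℝ → ι → ℝ, (∀ t, HasDerivAt v (A.mulVec (v t) + g t) t) ∧
      ((∀ t < T, g t = 0) → ∀ t < T, v t = 0) :=
  exists_hasDerivAt_eq_clm_add (LinearMap.toContinuousLinearMap A.mulVecLin) hg T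

lemma vecDistr_of_hasDerivAt {κ : Type*} [Fintype κ] {v v' : ℝ → κ → ℝ}
    (h : ∀ t, HasDerivAt v (v' t) t) (hv' : ∀ j, Continuous fun t => v' t j)
    (hv : ∀ j, Continuous fun t => v t j) :
    (X : ℝ[X]) • vecDistr (fun j => ofCont (fun t => v t j) (hv j)) =
      vecDistr fun j => ofCont (fun t => v' t j) (hv' j) :=
  funext fun j => X_smul_toDistr_of_hasDerivAt (hv' j) (fun t => hasDerivAt_pi.1 (h t) j) (hv j)

/-- The state equation has a locally integrable solution for every locally integrable
forcing. -/
lemma exists_state_solution {ι : Type*} [Fintype ι] (A : Matrix ι ι ℝ) (G : ι → LocInt) :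
    ∃ Z : ι → LocInt,
      (X : ℝ[X]) • vecDistr Z = act (const A) (vecDistr Z) + vecDistr G := by
  -- Subtracting the primitive of the forcing makes the new forcing continuous.
  set J : ι → LocInt := fun i => primitive (G i) with hJ
  have hJX : (X : ℝ[X]) • vecDistr J = vecDistr G :=
    funext fun i => X_smul_toDistr_primitive (G i)
  have hJc : Continuous (vecFun J) := continuous_pi fun i => continuous_integ (G i).2
  have hg : Continuous fun t => A.mulVec (vecFun J t) := continuous_const.matrix_mulVec hJc
  obtain ⟨v, hv, -⟩ := exists_hasDerivAt_eq_mulVec_add A hg 0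
  have hvc : Continuous v := continuous_iff_continuousAt.2 fun t => (hv t).continuousAt
  have hvc' : ∀ j, Continuous fun t => v t j := fun j => (continuous_apply j).comp hvc
  have hv'c : Continuous fun t => A.mulVec (v t) + A.mulVec (vecFun J t) :=
    (continuous_const.matrix_mulVec hvc).add hg
  have hv'c' : ∀ j, Continuous fun t => (A.mulVec (v t) + A.mulVec (vecFun J t)) j :=
    fun j => (continuous_apply j).comp hv'c
  set V : ι → LocInt := fun j => ofCont (fun t => v t j) (hvc' j) with hV
  have hVX : (X : ℝ[X]) • vecDistr V = act (const A) (vecDistr (V + J)) := by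
    rw [hV, vecDistr_of_hasDerivAt hv hv'c' hvc', ← vecDistr_matFun]
    congr 1
    funext j
    ext t
    have := congrFun (vecFun_matFun A (V + J) t) j
    change _ = vecFun (matFun A (V + J)) t j
    rw [this]
    have e : vecFun (V + J) t = v t + vecFun J t := rfl
    rw [e, Matrix.mulVec_add]
    rfl
  refine ⟨V + J, ?_⟩
  rw [vecDistr_add V J, smul_add, hVX, hJX, vecDistr_add]

/-- Distributions of finite order: the derivatives of locally integrable functions. -/
def finiteOrder : Submodule ℝ[X] Distr where
  carrier := {w | ∃ (k : ℕ) (f : LocInt), w = (X ^ k : ℝ[X]) • toDistr f}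
  zero_mem' := ⟨0, 0, by simp⟩
  add_mem' := by
    rintro _ _ ⟨k, f, rfl⟩ ⟨l, g, rfl⟩
    refine ⟨k + l, (primitive ^ l) f + (primitive ^ k) g, ?_⟩
    rw [map_add, smul_add]
    conv_rhs => rw [pow_add, mul_smul, X_pow_smul_toDistr_primitive_pow, mul_comm, mul_smul,
      X_pow_smul_toDistr_primitive_pow]
  smul_mem' := by
    rintro p _ ⟨k, f, rfl⟩
    refine ⟨k + p.natDegree, ∑ m ∈ Finset.range (p.natDegree + 1),
      p.coeff m • (primitive ^ (p.natDegree - m)) f, ?_⟩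
    conv_lhs => rw [p.as_sum_range_C_mul_X_pow, Finset.sum_smul]
    rw [map_sum, Finset.smul_sum]
    refine Finset.sum_congr rfl fun m hm => ?_
    have hm' : k + p.natDegree = m + k + (p.natDegree - m) := by
      have := Finset.mem_range.1 hm
      omega
    conv_rhs => rw [map_smul, ← smul_comm (p.coeff m), hm', pow_add _ (m + k), mul_smul,
      X_pow_smul_toDistr_primitive_pow, pow_add, mul_smul]
    rw [mul_smul, Distr.C_smul]

lemma toDistr_mem_finiteOrder (f : LocInt) : toDistr f ∈ finiteOrder := ⟨0, f, by simp⟩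

lemma act_mem_finiteOrder {ι κ : Type*} [Fintype κ] (M : Matrix ι κ ℝ[X]) {w : κ → Distr}
    (hw : ∀ j, w j ∈ finiteOrder) (i : ι) : act M w i ∈ finiteOrder :=
  Submodule.sum_mem _ fun j _ => Submodule.smul_mem _ _ (hw j)

lemma exists_common_order {ι : Type*} [Fintype ι] {w : ι → Distr}
    (hw : ∀ i, w i ∈ finiteOrder) :
    ∃ (k : ℕ) (F : ι → LocInt), w = (X ^ k : ℝ[X]) • vecDistr F := by
  choose k f hf using hw
  refine ⟨Finset.univ.sup k, fun i => (primitive ^ (Finset.univ.sup k - k i)) (f i), ?_⟩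
  funext i
  have hi : Finset.univ.sup k = k i + (Finset.univ.sup k - k i) :=
    (Nat.add_sub_of_le (Finset.le_sup (Finset.mem_univ i))).symm
  rw [Pi.smul_apply, vecDistr]
  conv_rhs => rw [hi, pow_add, mul_smul, Nat.add_sub_cancel_left,
    X_pow_smul_toDistr_primitive_pow]
  exact hf i

/-- A state trajectory of finite order with locally integrable input is locally integrable:
the state equation writes its derivative as a derivative of the same order, so integrating
it lowers the order. -/
lemma exists_vecDistr_eq_of_state {ι : Type*} [Fintype ι] (A : Matrix ι ι ℝ) (G : ι → LocInt)
    {w : ι → Distr} (hw : ∀ i, w i ∈ finiteOrder)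
    (h : (X : ℝ[X]) • w = act (const A) w + vecDistr G) : ∃ Z : ι → LocInt, w = vecDistr Z := by
  obtain ⟨k, F, rfl⟩ := exists_common_order hw
  clear hw
  induction k generalizing F with
  | zero => exact ⟨F, by simp⟩
  | succ k ih =>
    set E : ι → LocInt := matFun A F + fun i => (primitive ^ (k + 1)) (G i) with hE
    have h1 : (X : ℝ[X]) • (X ^ (k + 1) : ℝ[X]) • vecDistr F =
        (X : ℝ[X]) • (X ^ k : ℝ[X]) • vecDistr E := by
      rw [h, act_smul, ← vecDistr_matFun, smul_smul, ← pow_succ', hE, vecDistr_add, smul_add]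
      congr 1
      funext i
      exact (X_pow_smul_toDistr_primitive_pow (k + 1) (G i)).symm
    have h2 : ∀ i, ∃ c : ℝ, ((X ^ (k + 1) : ℝ[X]) • vecDistr F) i =
        ((X ^ k : ℝ[X]) • vecDistr E) i + c • oneDistr := by
      intro i
      have := congrFun h1 i
      rw [Pi.smul_apply, Pi.smul_apply X, ← sub_eq_zero, ← smul_sub] at this
      obtain ⟨c, hc⟩ := exists_eq_const_of_X_smul_eq_zero this
      exact ⟨c, sub_eq_iff_eq_add'.1 hc⟩
    choose c hc using h2
    have h3 : (X ^ (k + 1) : ℝ[X]) • vecDistr F = (X ^ k : ℝ[X]) • vecDistr (E + fun i =>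
        c i • (primitive ^ k) (ofCont (fun _ => 1) continuous_const)) := by
      funext i
      rw [hc, vecDistr_add E, smul_add]
      congr 1
      change _ = (X ^ k : ℝ[X]) • toDistr (c i • _)
      rw [map_smul, smul_comm, X_pow_smul_toDistr_primitive_pow]
      rfl
    rw [h3] at h ⊢
    exact ih _ h

/-- The external behavior of a realization is the behavior it realizes. -/
lemma Realization.act_eq_iff {n d : ℕ} {P Q : Matrix (Fin n) (Fin n) ℝ[X]}
    (S : Realization P Q d) (U Y : Fin n → LocInt) :
    act P (vecDistr U) = act Q (vecDistr Y) ↔ ∃ Z : Fin d → LocInt,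
      (X : ℝ[X]) • vecDistr Z = act (const S.A) (vecDistr Z) + act (const S.B) (vecDistr U) ∧
      vecDistr Y = act (const S.C) (vecDistr Z) + act (const S.D) (vecDistr U) := by
  constructor
  · intro h
    obtain ⟨h1, h2⟩ := S.state_of_act_eq h
    have h1' := h1
    rw [← vecDistr_matFun S.B] at h1'
    obtain ⟨Z, hZ⟩ := exists_vecDistr_eq_of_state
      (w := act S.r (vecDistr Y) - act S.H (vecDistr U)) S.A (matFun S.B U) (fun i =>
      Submodule.sub_mem _ (act_mem_finiteOrder S.r (fun j => toDistr_mem_finiteOrder (Y j)) i)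
        (act_mem_finiteOrder S.H (fun j => toDistr_mem_finiteOrder (U j)) i)) h1'
    rw [hZ] at h1 h2
    exact ⟨Z, h1, h2⟩
  · rintro ⟨Z, h1, h2⟩
    exact S.act_eq_of_state h1 h2

/-! ### Reciprocity makes the transfer matrix symmetric -/

namespace TestFun

/-- A test function, as a locally integrable function. -/
def toLocInt (φ : TestFun) : LocInt := ofCont φ φ.continuous

/-- The image of a test function under a constant-coefficient differential operator. -/
def applyPoly (p : ℝ[X]) (φ : TestFun) : TestFun := aeval TestFun.deriv p φ

lemma applyPoly_add (p q : ℝ[X]) (φ : TestFun) :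
    applyPoly (p + q) φ = applyPoly p φ + applyPoly q φ := by
  simp [applyPoly]

lemma applyPoly_C (c : ℝ) (φ : TestFun) : applyPoly (C c) φ = c • φ := by
  simp [applyPoly]

lemma applyPoly_mul_X (p : ℝ[X]) (φ : TestFun) :
    applyPoly (p * X) φ = applyPoly p (TestFun.deriv φ) := by
  simp [applyPoly]

lemma toDistr_applyPoly (p : ℝ[X]) (φ : TestFun) :
    toDistr (applyPoly p φ).toLocInt = p • toDistr φ.toLocInt := by
  have hadd : ∀ φ ψ : TestFun, (φ + ψ).toLocInt = φ.toLocInt + ψ.toLocInt := fun _ _ => rfl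
  have hsmul : ∀ (c : ℝ) (φ : TestFun), (c • φ).toLocInt = c • φ.toLocInt := fun _ _ => rfl
  induction p using Polynomial.induction_on generalizing φ with
  | C c => rw [applyPoly_C, hsmul, map_smul, Distr.C_smul]
  | add p q hp hq => rw [applyPoly_add, hadd, map_add, hp, hq, add_smul]
  | monomial k c h =>
    rw [pow_succ, ← mul_assoc, applyPoly_mul_X, h, mul_smul (C c * X ^ k) X]
    congr 1
    exact (X_smul_toDistr_of_hasDerivAt (TestFun.deriv φ).continuous φ.hasDerivAt
      φ.continuous).symm

lemma integrable_mul_exp (s : ℝ) (φ : TestFun) :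
    Integrable fun t => (φ : ℝ → ℝ) t * Real.exp (-(s * t)) :=
  (φ.continuous.mul (by fun_prop)).integrable_of_hasCompactSupport
    φ.hasCompactSupport.mul_right

/-- The two-sided Laplace transform of a test function, at a real point. -/
def laplace (s : ℝ) (φ : TestFun) : ℝ := ∫ t, (φ : ℝ → ℝ) t * Real.exp (-(s * t))

lemma laplace_add (s : ℝ) (φ ψ : TestFun) :
    laplace s (φ + ψ) = laplace s φ + laplace s ψ := by
  rw [laplace, laplace, laplace, ← integral_add (φ.integrable_mul_exp s) (ψ.integrable_mul_exp s)]
  simp [add_mul]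

lemma laplace_smul (s c : ℝ) (φ : TestFun) : laplace s (c • φ) = c * laplace s φ := by
  rw [laplace, laplace, ← integral_const_mul]
  simp [mul_assoc]

lemma laplace_deriv (s : ℝ) (φ : TestFun) :
    laplace s (TestFun.deriv φ) = s * laplace s φ := by
  have hd : ∀ t, HasDerivAt (fun t => (φ : ℝ → ℝ) t * Real.exp (-(s * t)))
      ((TestFun.deriv φ : ℝ → ℝ) t * Real.exp (-(s * t)) +
        -s * ((φ : ℝ → ℝ) t * Real.exp (-(s * t)))) t := by
    intro t
    have he : HasDerivAt (fun t => Real.exp (-(s * t))) (Real.exp (-(s * t)) * -(s * 1)) t :=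
      (((hasDerivAt_id t).const_mul s).neg).exp
    refine ((φ.hasDerivAt t).mul he).congr_deriv ?_
    ring
  have h1 := (TestFun.deriv φ).integrable_mul_exp s
  have h2 := (φ.integrable_mul_exp s).const_mul (-s)
  have := integral_eq_zero_of_hasDerivAt_of_integrable hd (h1.add h2) (φ.integrable_mul_exp s)
  rw [integral_add h1 h2, integral_const_mul] at this
  rw [laplace, laplace]
  linarith

lemma laplace_applyPoly (s : ℝ) (p : ℝ[X]) (φ : TestFun) :
    laplace s (applyPoly p φ) = p.eval s * laplace s φ := by
  induction p using Polynomial.induction_on generalizing φ with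
  | C c => rw [applyPoly_C, laplace_smul, eval_C]
  | add p q hp hq => rw [applyPoly_add, laplace_add, hp, hq, eval_add, add_mul]
  | monomial k c h =>
    rw [pow_succ, ← mul_assoc, applyPoly_mul_X, h, laplace_deriv, eval_mul (p := C c * X ^ k),
      eval_X, mul_assoc]

lemma laplace_pos {φ : TestFun} (h0 : ∀ t, 0 ≤ (φ : ℝ → ℝ) t) (h1 : 0 < (φ : ℝ → ℝ) 0) (s : ℝ) :
    0 < laplace s φ := by
  refine (φ.continuous.mul (by fun_prop)).integral_pos_of_hasCompactSupport_nonneg_nonzero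
    φ.hasCompactSupport.mul_right (fun t => mul_nonneg (h0 t) (Real.exp_nonneg _)) (x := 0) ?_
  exact (mul_pos h1 (Real.exp_pos _)).ne'

end TestFun

/-- The vector-valued function with given test functions as components. -/
def testVec {n : ℕ} (F : Fin n → TestFun) : ℝ → Fin n → ℝ := vecFun fun i => (F i).toLocInt

lemma testVec_mem_DPlus {n : ℕ} (F : Fin n → TestFun) : testVec F ∈ DPlus n := by
  refine ⟨contDiff_pi.2 fun i => (F i).contDiff, ?_⟩
  choose R hR h using fun i => (F i).exists_bound
  refine ⟨-∑ i, R i, fun t ht => funext fun i => h i t ?_⟩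
  have := Finset.single_le_sum (f := R) (fun i _ => (hR i).le) (Finset.mem_univ i)
  exact le_trans (by linarith) (neg_le_abs t)

/-- The Laplace transform turns convolutions into products. -/
lemma integral_conv_mul_exp {n : ℕ} (F G : Fin n → TestFun) (s : ℝ) :
    ∫ t, conv (testVec F) (testVec G) t * Real.exp (-(s * t)) =
      ∑ i, (F i).laplace s * (G i).laplace s := by
  let f : Fin n → ℝ → ℝ := fun i t => (F i : ℝ → ℝ) t * Real.exp (-(s * t))
  let g : Fin n → ℝ → ℝ := fun i t => (G i : ℝ → ℝ) t * Real.exp (-(s * t))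
  have hf : ∀ i, Integrable (f i) := fun i => (F i).integrable_mul_exp s
  have hg : ∀ i, Integrable (g i) := fun i => (G i).integrable_mul_exp s
  have key : ∀ t, conv (testVec F) (testVec G) t * Real.exp (-(s * t)) =
      ∑ i, convolution (f i) (g i) (ContinuousLinearMap.mul ℝ ℝ) volume t := by
    intro t
    have h1 : conv (testVec F) (testVec G) t =
        ∑ i, ∫ τ, (F i : ℝ → ℝ) τ * (G i : ℝ → ℝ) (t - τ) := by
      rw [← integral_finsetSum]
      · rfl
      · intro i _
        exact ((F i).continuous.mul ((G i).continuous.comp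
          (continuous_const.sub continuous_id))).integrable_of_hasCompactSupport
          (F i).hasCompactSupport.mul_right
    rw [h1, Finset.sum_mul]
    refine Finset.sum_congr rfl fun i _ => ?_
    rw [← integral_mul_const, convolution_def]
    refine integral_congr_ae (Filter.Eventually.of_forall fun τ => ?_)
    have : Real.exp (-(s * t)) = Real.exp (-(s * τ)) * Real.exp (-(s * (t - τ))) := by
      rw [← Real.exp_add]
      ring_nf
    simp only [ContinuousLinearMap.mul_apply', f, g, this]
    ring
  simp_rw [key]
  rw [integral_finsetSum _ fun i _ =>
    (hf i).integrable_convolution (ContinuousLinearMap.mul ℝ ℝ) (hg i)]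
  refine Finset.sum_congr rfl fun i _ => ?_
  rw [integral_convolution _ (hf i) (hg i)]
  rfl

lemma act_column {V ι κ μ : Type*} [AddCommGroup V] [Module ℝ[X] V] [Fintype κ]
    (M : Matrix ι κ ℝ[X]) (N : Matrix κ μ ℝ[X]) (k : μ) (w : V) :
    act M (fun j => N j k • w) = fun i => (M * N) i k • w := by
  funext i
  simp [act, Matrix.mul_apply, Finset.sum_smul, mul_smul]

/-- Reciprocity, tested on the trajectories `u = (det Q)(d/dt) φ e_k` and
`y = (adj(Q) P)(d/dt) φ e_k`. -/
lemma mul_transpose_eq_of_isReciprocal {n : ℕ} {P Q : Matrix (Fin n) (Fin n) ℝ[X]}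
    (hQ : Q.det ≠ 0) (h : IsReciprocal (ioBehavior P Q)) :
    P * Q.transpose = Q * P.transpose := by
  obtain ⟨φ, h0, h1, -⟩ := exists_testFun_integral_eq_one
  set M : Matrix (Fin n) (Fin n) ℝ[X] := Q.det • (1 : Matrix (Fin n) (Fin n) ℝ[X]) with hM
  set N := Q.adjugate * P with hN
  have hPQ : P * M = Q * N := by
    rw [hM, hN, Matrix.mul_smul, Matrix.mul_one, ← Matrix.mul_assoc, Matrix.mul_adjugate,
      Matrix.smul_mul, Matrix.one_mul]
  let col : Matrix (Fin n) (Fin n) ℝ[X] → Fin n → Fin n → TestFun :=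
    fun W k i => TestFun.applyPoly (W i k) φ
  have hmem : ∀ k, (testVec (col M k), testVec (col N k)) ∈
      ioBehavior P Q ∩ DPlus n ×ˢ DPlus n := by
    intro k
    refine ⟨(mem_ioBehavior_iff P Q _ _).2 ?_, testVec_mem_DPlus _, testVec_mem_DPlus _⟩
    have e : ∀ W, vecDistr (fun i => (col W k i).toLocInt) =
        fun i => W i k • toDistr φ.toLocInt := fun W =>
      funext fun i => TestFun.toDistr_applyPoly (W i k) φ
    rw [e, e, act_column, act_column, hPQ]
  have hsymm : N.transpose = N := by
    ext1 l k
    rw [Matrix.transpose_apply]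
    refine mul_left_cancel₀ hQ (Polynomial.funext fun s => ?_)
    have hc := congrArg (fun f : ℝ → ℝ => ∫ t, f t * Real.exp (-(s * t)))
      (h _ (hmem k) _ (hmem l))
    simp only [integral_conv_mul_exp] at hc
    have hpos := TestFun.laplace_pos h0 h1 s
    simp only [col, TestFun.laplace_applyPoly, hM, Matrix.smul_apply, Matrix.one_apply,
      smul_eq_mul, mul_ite, mul_one, mul_zero, apply_ite (Polynomial.eval s), eval_zero, ite_mul,
      zero_mul, Finset.sum_ite_eq', Finset.mem_univ, if_true] at hc
    rw [eval_mul, eval_mul]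
    have h2 := hpos.ne'
    apply mul_right_cancel₀ h2
    apply mul_right_cancel₀ h2
    linear_combination hc
  have h1 := congrArg (fun Z => Q * Z * Q.transpose) hsymm
  simp only [hN, Matrix.transpose_mul] at h1
  rw [← Matrix.mul_assoc Q, ← Matrix.mul_assoc Q, Matrix.mul_adjugate, Matrix.mul_assoc,
    ← Matrix.transpose_mul, Matrix.mul_adjugate, Matrix.transpose_smul, Matrix.transpose_one,
    Matrix.mul_smul, Matrix.mul_one, Matrix.smul_mul, Matrix.one_mul, Matrix.smul_mul] at h1
  ext1 i j
  exact (mul_left_cancel₀ hQ (congrFun (congrFun h1 i) j)).symm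

/-! ### A signature-symmetric realization -/

lemma act_const {ι κ : Type*} [Fintype κ] (M : Matrix ι κ ℝ) (w : κ → Distr) :
    act (const M) w = act M w := by
  funext i
  simp only [act, Matrix.map_apply, Distr.C_smul]

lemma act_smul_matrix {R V ι κ : Type*} [CommRing R] [AddCommGroup V] [Module R V] [Fintype κ]
    (c : R) (M : Matrix ι κ R) (w : κ → V) : act (c • M) w = c • act M w := by
  funext i
  simp [act, Finset.smul_sum, mul_smul]

lemma act_X_smul {ι κ : Type*} [Fintype κ] (M : Matrix ι κ ℝ) (w : κ → Distr) :
    act M ((X : ℝ[X]) • w) = (X : ℝ[X]) • act M w := by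
  rw [← act_const, ← act_const, act_smul]

lemma vecDistr_smul {κ : Type*} (c : ℝ) (F : κ → LocInt) :
    vecDistr (c • F) = c • vecDistr F :=
  funext fun j => map_smul toDistr c (F j)

section Doubling

variable {n d : ℕ}

/-- The state matrix of the doubled system, the sum of a system with matrix `A` and its dual,
written in the sum and difference coordinates which diagonalize the duality pairing. -/
def doubleA (A : Matrix (Fin d) (Fin d) ℝ) : Matrix (Fin d ⊕ Fin d) (Fin d ⊕ Fin d) ℝ :=
  Matrix.fromBlocks ((1 / 2 : ℝ) • (A + A.transpose)) ((1 / 2 : ℝ) • (A - A.transpose))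
    ((1 / 2 : ℝ) • (A - A.transpose)) ((1 / 2 : ℝ) • (A + A.transpose))

/-- The input matrix of the doubled system. -/
def doubleB (B : Matrix (Fin d) (Fin n) ℝ) (C : Matrix (Fin n) (Fin d) ℝ) :
    Matrix (Fin d ⊕ Fin d) (Fin n) ℝ :=
  Matrix.fromRows (C.transpose + (1 / 4 : ℝ) • B) ((1 / 4 : ℝ) • B - C.transpose)

/-- The output matrix of the doubled system. -/
def doubleC (B : Matrix (Fin d) (Fin n) ℝ) (C : Matrix (Fin n) (Fin d) ℝ) :
    Matrix (Fin n) (Fin d ⊕ Fin d) ℝ :=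
  Matrix.fromCols (C + (1 / 4 : ℝ) • B.transpose) (C - (1 / 4 : ℝ) • B.transpose)

/-- The signature matrix of the doubled system. -/
def doubleSign (d : ℕ) : Matrix (Fin d ⊕ Fin d) (Fin d ⊕ Fin d) ℝ :=
  Matrix.fromBlocks 1 0 0 (-1)

lemma doubleA_mul_doubleSign (A : Matrix (Fin d) (Fin d) ℝ) :
    doubleA A * doubleSign d = doubleSign d * (doubleA A).transpose := by
  rw [doubleA, doubleSign, Matrix.fromBlocks_transpose, Matrix.fromBlocks_multiply,
    Matrix.fromBlocks_multiply]
  simp only [Matrix.transpose_smul, Matrix.transpose_add, Matrix.transpose_sub,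
    Matrix.transpose_transpose, Matrix.mul_one, Matrix.mul_zero, Matrix.mul_neg, Matrix.one_mul,
    Matrix.zero_mul, Matrix.neg_mul, add_zero, zero_add]
  congr 1 <;> module

lemma doubleSign_mul_doubleC_transpose (B : Matrix (Fin d) (Fin n) ℝ)
    (C : Matrix (Fin n) (Fin d) ℝ) :
    doubleSign d * (doubleC B C).transpose = doubleB B C := by
  rw [doubleSign, doubleC, doubleB, Matrix.transpose_fromCols, Matrix.fromBlocks_mul_fromRows]
  simp only [Matrix.transpose_smul, Matrix.transpose_add, Matrix.transpose_sub,
    Matrix.transpose_transpose, Matrix.one_mul, Matrix.zero_mul, Matrix.neg_mul, add_zero,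
    zero_add, neg_sub]

lemma act_fromBlocks {V ι κ ι' κ' : Type*} [AddCommGroup V] [Module ℝ V] [Fintype κ] [Fintype κ']
    (M₁₁ : Matrix ι κ ℝ) (M₁₂ : Matrix ι κ' ℝ) (M₂₁ : Matrix ι' κ ℝ) (M₂₂ : Matrix ι' κ' ℝ)
    (v : κ → V) (w : κ' → V) :
    act (Matrix.fromBlocks M₁₁ M₁₂ M₂₁ M₂₂) (Sum.elim v w) =
      Sum.elim (act M₁₁ v + act M₁₂ w) (act M₂₁ v + act M₂₂ w) := by
  ext1 (i | i) <;> simp [act]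

lemma act_fromRows {V ι ι' κ : Type*} [AddCommGroup V] [Module ℝ V] [Fintype κ]
    (M : Matrix ι κ ℝ) (N : Matrix ι' κ ℝ) (v : κ → V) :
    act (Matrix.fromRows M N) v = Sum.elim (act M v) (act N v) := by
  ext1 (i | i) <;> rfl

lemma vecDistr_elim {ι κ : Type*} (F : ι → LocInt) (G : κ → LocInt) :
    vecDistr (Sum.elim F G) = Sum.elim (vecDistr F) (vecDistr G) := by
  ext1 (i | i) <;> rfl

/-- The equations of the doubled system, for a state with components `p` and `m`. -/
lemma double_equations_iff (A : Matrix (Fin d) (Fin d) ℝ) (B : Matrix (Fin d) (Fin n) ℝ)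
    (C : Matrix (Fin n) (Fin d) ℝ) (D : Matrix (Fin n) (Fin n) ℝ)
    (u y : Fin n → Distr) (p m : Fin d → Distr) :
    ((X : ℝ[X]) • (Sum.elim p m : Fin d ⊕ Fin d → Distr) =
        act (doubleA A) (Sum.elim p m) + act (doubleB B C) u ∧
      y = act (doubleC B C) (Sum.elim p m) + act D u) ↔
    (X : ℝ[X]) • (p + m) = act A (p + m) + (1 / 2 : ℝ) • act B u ∧
      (X : ℝ[X]) • (p - m) = act A.transpose (p - m) + (2 : ℝ) • act C.transpose u ∧
      y = act C (p + m) + (1 / 4 : ℝ) • act B.transpose (p - m) + act D u := by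
  have hsplit : ∀ p' m' : Fin d → Distr,
      (X : ℝ[X]) • (Sum.elim p m : Fin d ⊕ Fin d → Distr) = Sum.elim p' m' ↔
        (X : ℝ[X]) • (p + m) = p' + m' ∧ (X : ℝ[X]) • (p - m) = p' - m' := by
    intro p' m'
    have e : (X : ℝ[X]) • (Sum.elim p m : Fin d ⊕ Fin d → Distr) =
        Sum.elim ((X : ℝ[X]) • p) ((X : ℝ[X]) • m) := by
      ext1 (i | i) <;> rfl
    rw [e, smul_add, smul_sub]
    constructor
    · intro h
      have h1 : (X : ℝ[X]) • p = p' := funext fun i => congrFun h (Sum.inl i)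
      have h2 : (X : ℝ[X]) • m = m' := funext fun i => congrFun h (Sum.inr i)
      rw [h1, h2]
      exact ⟨rfl, rfl⟩
    · rintro ⟨h1, h2⟩
      have h3 : (X : ℝ[X]) • p = p' := by
        have e1 : (X : ℝ[X]) • p = (1 / 2 : ℝ) • (((X : ℝ[X]) • p + (X : ℝ[X]) • m) +
            ((X : ℝ[X]) • p - (X : ℝ[X]) • m)) := by
          generalize (X : ℝ[X]) • p = p₁, (X : ℝ[X]) • m = m₁
          module
        rw [e1, h1, h2]
        module
      have h4 : (X : ℝ[X]) • m = m' := by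
        have e1 : (X : ℝ[X]) • m = (1 / 2 : ℝ) • (((X : ℝ[X]) • p + (X : ℝ[X]) • m) -
            ((X : ℝ[X]) • p - (X : ℝ[X]) • m)) := by
          generalize (X : ℝ[X]) • p = p₁, (X : ℝ[X]) • m = m₁
          module
        rw [e1, h1, h2]
        module
      rw [h3, h4]
  have hadd : ∀ a b a' b' : Fin d → Distr, (Sum.elim a b : Fin d ⊕ Fin d → Distr) + Sum.elim a' b'
      = Sum.elim (a + a') (b + b') := by
    intro a b a' b'
    ext1 (i | i) <;> rfl
  rw [doubleA, doubleB, doubleC, act_fromBlocks, act_fromRows, act_fromCols, hadd, hsplit,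
    and_assoc]
  simp only [act_add, act_sub, act_smul_matrix, act_vadd, act_vsub]
  refine and_congr (Eq.congr_right ?_) (and_congr (Eq.congr_right ?_) (Eq.congr_right ?_)) <;>
    module

/-- A system intertwined with its dual has the same external behavior as the doubled system.
The state of the system is `p + m + (1/4) Φ (p - m)`, where `p` and `m` are the components of the
state of the doubled system. -/
lemma exists_state_iff_exists_double_state {A Φ : Matrix (Fin d) (Fin d) ℝ}
    {B : Matrix (Fin d) (Fin n) ℝ} {C : Matrix (Fin n) (Fin d) ℝ} (D : Matrix (Fin n) (Fin n) ℝ)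
    (hA : A * Φ = Φ * A.transpose) (hB : Φ * C.transpose = B) (hΦ : Φ.transpose = Φ)
    (U : Fin n → LocInt) (y : Fin n → Distr) :
    (∃ Z : Fin d → LocInt, (X : ℝ[X]) • vecDistr Z = act A (vecDistr Z) + act B (vecDistr U) ∧
        y = act C (vecDistr Z) + act D (vecDistr U)) ↔
      ∃ Z : Fin d ⊕ Fin d → LocInt, (X : ℝ[X]) • vecDistr Z =
          act (doubleA A) (vecDistr Z) + act (doubleB B C) (vecDistr U) ∧
        y = act (doubleC B C) (vecDistr Z) + act D (vecDistr U) := by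
  have hAw : ∀ w : Fin d → Distr, act Φ (act A.transpose w) = act A (act Φ w) := fun w => by
    rw [← act_mul, ← act_mul, hA]
  have hBw : ∀ w : Fin n → Distr, act Φ (act C.transpose w) = act B w := fun w => by
    rw [← act_mul, hB]
  have hCw : ∀ w : Fin d → Distr, act C (act Φ w) = act B.transpose w := fun w => by
    rw [← act_mul, ← hB, Matrix.transpose_mul, Matrix.transpose_transpose, hΦ]
  constructor
  · rintro ⟨Z, h1, h2⟩
    obtain ⟨Δ, hΔ⟩ := exists_state_solution A.transpose (matFun ((2 : ℝ) • C.transpose) U)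
    rw [vecDistr_matFun, act_const, act_const, act_smul_matrix] at hΔ
    set S : Fin d → LocInt := Z - (1 / 4 : ℝ) • matFun Φ Δ with hS
    refine ⟨Sum.elim ((1 / 2 : ℝ) • (S + Δ)) ((1 / 2 : ℝ) • (S - Δ)), ?_⟩
    have e1 : vecDistr ((1 / 2 : ℝ) • (S + Δ)) + vecDistr ((1 / 2 : ℝ) • (S - Δ)) =
        vecDistr Z - (1 / 4 : ℝ) • act Φ (vecDistr Δ) := by
      rw [← vecDistr_add, ← smul_add, add_add_sub_cancel, ← act_const, ← vecDistr_matFun,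
        ← vecDistr_smul, ← vecDistr_sub, ← hS]
      congr 1
      module
    have e2 : vecDistr ((1 / 2 : ℝ) • (S + Δ)) - vecDistr ((1 / 2 : ℝ) • (S - Δ)) =
        vecDistr Δ := by
      rw [← vecDistr_sub]
      congr 1
      module
    rw [vecDistr_elim, double_equations_iff, e1, e2]
    refine ⟨?_, hΔ, ?_⟩
    · rw [smul_sub, h1, smul_comm, ← act_X_smul, hΔ]
      simp only [act_vadd, act_vsub, hAw, hBw, act_smul]
      module
    · rw [h2]
      simp only [act_vsub, act_smul, hCw]
      module
  · rintro ⟨Z, hZ⟩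
    obtain ⟨p, m, rfl⟩ : ∃ p m : Fin d → LocInt, Z = Sum.elim p m :=
      ⟨Z ∘ Sum.inl, Z ∘ Sum.inr, (Sum.elim_comp_inl_inr Z).symm⟩
    rw [vecDistr_elim, double_equations_iff] at hZ
    obtain ⟨h1, h2, h3⟩ := hZ
    refine ⟨p + m + (1 / 4 : ℝ) • matFun Φ (p - m), ?_⟩
    rw [vecDistr_add, vecDistr_smul, vecDistr_matFun, act_const, vecDistr_add, vecDistr_sub]
    constructor
    · rw [smul_add, h1, smul_comm, ← act_X_smul, h2]
      simp only [act_vadd, act_vsub, hAw, hBw, act_smul]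
      module
    · rw [h3]
      simp only [act_vadd, act_vsub, act_smul, hCw]

end Doubling

lemma act_submatrix {V ι ι' κ κ' : Type*} [AddCommGroup V] [Module ℝ V] [Fintype κ] [Fintype κ']
    (M : Matrix ι κ ℝ) (f : ι' → ι) (e : κ' ≃ κ) (w : κ' → V) :
    act (M.submatrix f e) w = act M (w ∘ e.symm) ∘ f := by
  funext i
  simp only [act, Matrix.submatrix_apply, Function.comp_apply]
  exact Fintype.sum_equiv e _ _ fun j => by simp

/-- Reindexing the state variables does not change the external behavior. -/
lemma exists_state_iff_submatrix {ι : Type*} [Fintype ι] {n d : ℕ} (e : Fin d ≃ ι)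
    (A : Matrix ι ι ℝ) (B : Matrix ι (Fin n) ℝ) (C : Matrix (Fin n) ι ℝ)
    (D : Matrix (Fin n) (Fin n) ℝ) (u y : Fin n → Distr) :
    (∃ Z : ι → LocInt, (X : ℝ[X]) • vecDistr Z = act A (vecDistr Z) + act B u ∧
        y = act C (vecDistr Z) + act D u) ↔
      ∃ Z : Fin d → LocInt, (X : ℝ[X]) • vecDistr Z =
          act (A.submatrix e e) (vecDistr Z) + act (B.submatrix e id) u ∧
        y = act (C.submatrix id e) (vecDistr Z) + act D u := by
  have hB : act (B.submatrix e id) u = act B u ∘ e := rfl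
  simp only [act_submatrix, hB, Function.comp_id]
  constructor
  · rintro ⟨Z, h1, h2⟩
    refine ⟨Z ∘ e, ?_⟩
    have hZ : vecDistr (Z ∘ e) ∘ e.symm = vecDistr Z := by
      funext i
      simp [vecDistr]
    rw [hZ]
    exact ⟨congrArg (fun w => w ∘ e) h1, h2⟩
  · rintro ⟨Z, h1, h2⟩
    refine ⟨Z ∘ e.symm, ?_, h2⟩
    have := congrArg (fun w => w ∘ e.symm) h1
    funext i
    have h3 := congrFun this i
    simp only [Function.comp_apply, Pi.add_apply, Equiv.apply_symm_apply, Pi.smul_apply] at h3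
    exact h3

lemma behavior_ext {n d : ℕ} {P Q : Matrix (Fin n) (Fin n) ℝ[X]} {A : Matrix (Fin d) (Fin d) ℝ}
    {B : Matrix (Fin d) (Fin n) ℝ} {C : Matrix (Fin n) (Fin d) ℝ} {D : Matrix (Fin n) (Fin n) ℝ}
    (h : ∀ U Y : Fin n → LocInt, (vecFun U, vecFun Y) ∈ ioBehavior P Q ↔
      (vecFun U, vecFun Y) ∈ externalBehavior A B C D) :
    ioBehavior P Q = externalBehavior A B C D := by
  ext ⟨u, y⟩
  constructor
  · intro hm
    obtain ⟨U, rfl⟩ := exists_vecFun_eq hm.1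
    obtain ⟨Y, rfl⟩ := exists_vecFun_eq hm.2.1
    exact (h U Y).1 hm
  · intro hm
    obtain ⟨x, hx⟩ := id hm
    obtain ⟨U, rfl⟩ := exists_vecFun_eq hx.1
    obtain ⟨Y, rfl⟩ := exists_vecFun_eq hx.2.1
    exact (h U Y).2 hm

/-- If `Q⁻¹ P` is proper and symmetric, the doubled system of a realization is a
signature-symmetric system with the same external behavior. -/
lemma exists_signature_realization {n : ℕ} {P Q : Matrix (Fin n) (Fin n) ℝ[X]} (hQ : Q.det ≠ 0)
    (hproper : ∀ i j, IsProperRat (transferMatrix P Q i j))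
    (hsymm : P * Q.transpose = Q * P.transpose) :
    ∃ (d : ℕ) (A : Matrix (Fin d) (Fin d) ℝ) (B : Matrix (Fin d) (Fin n) ℝ)
      (C : Matrix (Fin n) (Fin d) ℝ) (D : Matrix (Fin n) (Fin n) ℝ)
      (S : Matrix (Fin d) (Fin d) ℝ), IsSignature S ∧
        ioBehavior P Q = externalBehavior A B C D ∧
        A * S = S * A.transpose ∧ S * C.transpose = B ∧ D = D.transpose := by
  obtain ⟨d, ⟨R⟩⟩ := exists_realization hQ hproper
  obtain ⟨Φ, hA, hB, hΦ, hD⟩ := R.exists_intertwiner hQ hsymm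
  let e : Fin (d + d) ≃ Fin d ⊕ Fin d := finSumFinEquiv.symm
  refine ⟨d + d, (doubleA R.A).submatrix e e, (doubleB R.B R.C).submatrix e id,
    (doubleC R.B R.C).submatrix id e, R.D, (doubleSign d).submatrix e e, ⟨?_, ?_⟩, ?_, ?_, ?_,
    hD.symm⟩
  · intro i j hij
    rw [Matrix.submatrix_apply]
    have hij' : e i ≠ e j := fun h => hij (e.injective h)
    generalize e i = i' at *
    generalize e j = j' at *
    rcases i' with i' | i' <;> rcases j' with j' | j' <;>
      simp_all [doubleSign]
  · intro i
    rw [Matrix.submatrix_apply]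
    generalize e i = i'
    rcases i' with i' | i' <;> simp [doubleSign]
  · refine behavior_ext fun U Y => ?_
    rw [mem_ioBehavior_iff, R.act_eq_iff, mem_externalBehavior_iff]
    simp only [act_const]
    rw [exists_state_iff_exists_double_state R.D hA hB hΦ, exists_state_iff_submatrix e]
  · rw [Matrix.transpose_submatrix, Matrix.submatrix_mul_equiv, Matrix.submatrix_mul_equiv,
      doubleA_mul_doubleSign]
  · rw [Matrix.transpose_submatrix, Matrix.submatrix_mul_equiv, doubleSign_mul_doubleC_transpose]

/-! ### Signature symmetry implies reciprocity -/

lemma eq_zero_of_hasDerivAt_clm {F : Type*} [NormedAddCommGroup F] [NormedSpace ℝ F]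
    (a : F →L[ℝ] F) {f : ℝ → F} (hf : ∀ t, HasDerivAt f (a (f t)) t) {t₀ : ℝ} (h0 : f t₀ = 0) :
    f = 0 :=
  ODE_solution_unique_univ (v := fun _ => a) (s := fun _ => Set.univ) (t₀ := t₀)
    (fun _ => a.lipschitz.lipschitzOnWith) (fun t => ⟨hf t, trivial⟩)
    (fun t => ⟨by simp, trivial⟩) h0

lemma eq_zero_of_hasDerivAt_mulVec {ι : Type*} [Fintype ι] (M : Matrix ι ι ℝ) {f : ℝ → ι → ℝ}
    (hf : ∀ t, HasDerivAt f (M.mulVec (f t)) t) {t₀ : ℝ} (h0 : f t₀ = 0) : f = 0 :=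
  eq_zero_of_hasDerivAt_clm (LinearMap.toContinuousLinearMap M.mulVecLin) hf h0

lemma X_pow_smul_toDistr_of_contDiff {f : ℝ → ℝ} (hf : ContDiff ℝ ∞ f) (k : ℕ) :
    (X ^ k : ℝ[X]) • toDistr (ofCont f hf.continuous) =
      toDistr (ofCont (iteratedDeriv k f)
        (hf.continuous_iteratedDeriv k (by exact_mod_cast le_top))) := by
  induction k with
  | zero => simp
  | succ k ih =>
    rw [pow_succ', mul_smul, ih]
    refine X_smul_toDistr_of_hasDerivAt _ (fun t => ?_) _
    rw [iteratedDeriv_succ]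
    exact ((hf.differentiable_iteratedDeriv k (by exact_mod_cast WithTop.coe_lt_top k))
      t).hasDerivAt

/-- Smooth functions which vanish near `-∞` solve no nontrivial homogeneous equation. -/
lemma eq_zero_of_monic_smul_toDistr_eq_zero {f : ℝ → ℝ} (hf : ContDiff ℝ ∞ f) {T : ℝ}
    (hT : ∀ t < T, f t = 0) {p : ℝ[X]} (hp : p.Monic)
    (h : p • toDistr (ofCont f hf.continuous) = 0) : f = 0 := by
  set m := p.natDegree with hm
  have hc : ∀ k, Continuous (iteratedDeriv k f) := fun k =>
    hf.continuous_iteratedDeriv k (by exact_mod_cast le_top)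
  have hd : ∀ (k : ℕ) t, HasDerivAt (iteratedDeriv k f) (iteratedDeriv (k + 1) f t) t := by
    intro k t
    rw [iteratedDeriv_succ]
    exact ((hf.differentiable_iteratedDeriv k (by exact_mod_cast WithTop.coe_lt_top k))
      t).hasDerivAt
  -- The equation holds pointwise.
  have hpt : ∀ t, iteratedDeriv m f t = -∑ k : Fin m, p.coeff k * iteratedDeriv k f t := by
    set g : LocInt := ∑ k ∈ Finset.range (m + 1), p.coeff k • ofCont (iteratedDeriv k f) (hc k)
      with hg
    have hgt : ∀ t, (g : ℝ → ℝ) t =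
        ∑ k ∈ Finset.range (m + 1), p.coeff k * iteratedDeriv k f t := by
      intro t
      simp [hg, Finset.sum_apply]
    have h1 : toDistr g = toDistr 0 := by
      rw [map_zero, ← h, hg, map_sum]
      conv_rhs => rw [p.as_sum_range_C_mul_X_pow, Finset.sum_smul]
      refine Finset.sum_congr rfl fun k _ => ?_
      rw [map_smul, mul_smul, Distr.C_smul, X_pow_smul_toDistr_of_contDiff hf]
    rw [toDistr_eq_iff] at h1
    have hgc : Continuous (g : ℝ → ℝ) := by
      rw [show (g : ℝ → ℝ) = _ from funext hgt]
      exact continuous_finsetSum _ fun k _ => continuous_const.mul (hc k)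
    have h2 := (hgc.ae_eq_iff_eq volume continuous_const).1 h1
    intro t
    have h3 : _ = (0 : ℝ) := (hgt t).symm.trans (congrFun h2 t)
    rw [Finset.sum_range_succ, hm, hp.coeff_natDegree, one_mul, ← hm, Finset.sum_range] at h3
    linarith
  rcases Nat.eq_zero_or_pos m with h0 | h0
  · funext t
    have := hpt t
    rw [h0] at this
    simpa using this
  -- The vector of the derivatives of order less than `m` solves a first-order system.
  let M : Matrix (Fin m) (Fin m) ℝ := fun i k =>
    if (i : ℕ) + 1 < m then (if (k : ℕ) = i + 1 then 1 else 0) else -p.coeff k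
  let F : ℝ → Fin m → ℝ := fun t i => iteratedDeriv i f t
  have hF : ∀ t, HasDerivAt F (M.mulVec (F t)) t := by
    intro t
    rw [hasDerivAt_pi]
    intro i
    refine (hd i t).congr_deriv ?_
    change _ = ∑ k, M i k * F t k
    by_cases hi : (i : ℕ) + 1 < m
    · rw [Finset.sum_eq_single (⟨i + 1, hi⟩ : Fin m)]
      · simp [M, F, hi]
      · intro k _ hk
        have : (k : ℕ) ≠ i + 1 := fun h => hk (Fin.ext h)
        simp [M, hi, this]
      · simp
    · have him : (i : ℕ) + 1 = m := by
        have := i.2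
        omega
      rw [him, hpt, ← Finset.sum_neg_distrib]
      refine Finset.sum_congr rfl fun k _ => ?_
      simp [M, F, hi]
  have hF0 : F (T - 1) = 0 := by
    funext i
    have : f =ᶠ[nhds (T - 1)] fun _ => 0 := by
      filter_upwards [Iio_mem_nhds (show T - 1 < T by linarith)] with s hs
      exact hT s hs
    change iteratedDeriv i f (T - 1) = 0
    rw [this.iteratedDeriv_eq]
    simp
  funext t
  have := congrFun (congrFun (eq_zero_of_hasDerivAt_mulVec M hF hF0) t) ⟨0, h0⟩
  simpa [F] using this

lemma contDiff_of_hasDerivAt_mulVec_add {ι : Type*} [Fintype ι] {A : Matrix ι ι ℝ}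
    {v g : ℝ → ι → ℝ} (hg : ContDiff ℝ ∞ g)
    (hv : ∀ t, HasDerivAt v (A.mulVec (v t) + g t) t) : ContDiff ℝ ∞ v := by
  have hA : ∀ {k : ℕ}, ContDiff ℝ k v → ContDiff ℝ k fun t => A.mulVec (v t) := fun h =>
    (LinearMap.toContinuousLinearMap A.mulVecLin).contDiff.comp h
  have hderiv : deriv v = fun t => A.mulVec (v t) + g t := funext fun t => (hv t).deriv
  refine contDiff_infty.2 fun k => ?_
  induction k with
  | zero =>
    exact contDiff_zero.2 (continuous_iff_continuousAt.2 fun t => (hv t).continuousAt)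
  | succ k ih =>
    have : ((k + 1 : ℕ) : WithTop ℕ∞) = (k : WithTop ℕ∞) + 1 := by norm_cast
    rw [this, contDiff_succ_iff_deriv]
    refine ⟨fun t => (hv t).differentiableAt, by simp, ?_⟩
    rw [hderiv]
    exact (hA ih).add (contDiff_infty.1 hg k)

/-- External trajectories which vanish near `-∞` have state trajectories which vanish
near `-∞`. -/
lemma exists_state_of_mem_DPlus {n d : ℕ} {A : Matrix (Fin d) (Fin d) ℝ}
    {B : Matrix (Fin d) (Fin n) ℝ} {C : Matrix (Fin n) (Fin d) ℝ} {D : Matrix (Fin n) (Fin n) ℝ}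
    {u y : ℝ → Fin n → ℝ} (h : (u, y) ∈ externalBehavior A B C D) (hu : u ∈ DPlus n)
    (hy : y ∈ DPlus n) :
    ∃ (x : ℝ → Fin d → ℝ) (T : ℝ), (∀ t, HasDerivAt x (A.mulVec (x t) + B.mulVec (u t)) t) ∧
      (∀ t < T, x t = 0) ∧ ∀ t, y t = C.mulVec (x t) + D.mulVec (u t) := by
  obtain ⟨huc, Tu, hTu⟩ := hu
  obtain ⟨hyc, Ty, hTy⟩ := hy
  have hlin : ∀ {k l : ℕ} (M : Matrix (Fin k) (Fin l) ℝ) {w : ℝ → Fin l → ℝ}, ContDiff ℝ ∞ w →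
      ContDiff ℝ ∞ fun t => M.mulVec (w t) := fun M _ hw =>
    (LinearMap.toContinuousLinearMap M.mulVecLin).contDiff.comp hw
  obtain ⟨x, hx, hx0⟩ := exists_hasDerivAt_eq_mulVec_add A (hlin B huc).continuous (min Tu Ty)
  have hx0' : ∀ t < min Tu Ty, x t = 0 := hx0 fun t ht => by
    rw [hTu t (ht.trans_le (min_le_left _ _)), Matrix.mulVec_zero]
  refine ⟨x, min Tu Ty, hx, hx0', ?_⟩
  have hxc : ContDiff ℝ ∞ x := contDiff_of_hasDerivAt_mulVec_add (hlin B huc) hx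
  set y₀ : ℝ → Fin n → ℝ := fun t => C.mulVec (x t) + D.mulVec (u t) with hy₀
  have hfc : ContDiff ℝ ∞ (y - y₀) := hyc.sub ((hlin C hxc).add (hlin D huc))
  have hf0 : ∀ t < min Tu Ty, (y - y₀) t = 0 := by
    intro t ht
    simp only [Pi.sub_apply, hy₀]
    rw [hTy t (ht.trans_le (min_le_right _ _)), hx0' t ht,
      hTu t (ht.trans_le (min_le_left _ _))]
    simp
  let U : Fin n → LocInt := fun i => ofCont (fun t => u t i) (contDiff_pi.1 huc i).continuous
  let Y : Fin n → LocInt := fun i => ofCont (fun t => y t i) (contDiff_pi.1 hyc i).continuous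
  let V : Fin d → LocInt := fun i => ofCont (fun t => x t i) (contDiff_pi.1 hxc i).continuous
  obtain ⟨Z, hZ1, hZ2⟩ := (mem_externalBehavior_iff A B C D U Y).1 h
  have hV : (X : ℝ[X]) • vecDistr V =
      act (const A) (vecDistr V) + act (const B) (vecDistr U) := by
    have hcont : ∀ j, Continuous fun t => (A.mulVec (x t) + B.mulVec (u t)) j := fun j =>
      (contDiff_pi.1 ((hlin A hxc).add (hlin B huc)) j).continuous
    rw [← vecDistr_matFun, ← vecDistr_matFun, ← vecDistr_add]
    refine (vecDistr_of_hasDerivAt hx hcont _).trans ?_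
    congr 1
    funext j
    ext t
    have h1 := congrFun (vecFun_matFun A V t) j
    have h2 := congrFun (vecFun_matFun B U t) j
    exact (congrArg₂ (· + ·) h1 h2).symm
  -- The difference of the two states is annihilated by the characteristic polynomial of `A`,
  -- and so is the difference of the outputs.
  have hE : A.charpoly • (vecDistr Z - vecDistr V) = 0 := by
    have h1 : act A.charmatrix (vecDistr Z - vecDistr V) = 0 := by
      rw [act_charmatrix, smul_sub, act_vsub, hZ1, hV]
      abel
    have h2 := congrArg (act A.charmatrix.adjugate) h1
    rwa [act_zero, ← act_mul, Matrix.adjugate_mul, ← Matrix.charpoly, act_smul_one] at h2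
  have hout : ∀ i, toDistr (ofCont (fun t => (y - y₀) t i) (contDiff_pi.1 hfc i).continuous) =
      act (const C) (vecDistr Z - vecDistr V) i := by
    intro i
    have h1 : vecDistr Y - (act (const C) (vecDistr V) + act (const D) (vecDistr U)) =
        act (const C) (vecDistr Z - vecDistr V) := by
      rw [hZ2, act_vsub]
      abel
    rw [← h1, ← vecDistr_matFun, ← vecDistr_matFun, ← vecDistr_add, ← vecDistr_sub]
    refine congrArg toDistr ?_
    ext t
    have h2 := congrFun (vecFun_matFun C V t) i
    have h3 := congrFun (vecFun_matFun D U t) i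
    exact (congrArg (fun z => y t i - z) (congrArg₂ (· + ·) h2 h3)).symm
  have hzero : ∀ i, (fun t => (y - y₀) t i) = 0 := by
    intro i
    refine eq_zero_of_monic_smul_toDistr_eq_zero (contDiff_pi.1 hfc i)
      (fun t ht => congrFun (hf0 t ht) i) A.charpoly_monic ?_
    rw [hout, ← Pi.smul_apply, ← act_smul, hE, act_zero]
    rfl
  intro t
  funext i
  exact sub_eq_zero.1 (congrFun (hzero i) t)

lemma integrable_dotProduct_comp_sub {n : ℕ} {v w : ℝ → Fin n → ℝ} (hv : Continuous v)
    (hw : Continuous w) {Tv Tw : ℝ} (hv0 : ∀ t < Tv, v t = 0) (hw0 : ∀ t < Tw, w t = 0) (t : ℝ) :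
    Integrable fun τ => v τ ⬝ᵥ w (t - τ) := by
  refine Continuous.integrable_of_hasCompactSupport ?_ ?_
  · exact hv.dotProduct (hw.comp (continuous_const.sub continuous_id))
  · refine HasCompactSupport.intro (isCompact_Icc (a := Tv) (b := t - Tw)) fun τ hτ => ?_
    rcases lt_or_ge τ Tv with h | h
    · rw [hv0 τ h, zero_dotProduct]
    · have : t - τ < Tw := by
        by_contra! hc
        exact hτ ⟨h, by linarith⟩
      rw [hw0 _ this, dotProduct_zero]

lemma IsSignature.mul_self {d : ℕ} {S : Matrix (Fin d) (Fin d) ℝ} (h : IsSignature S) :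
    S * S = 1 := by
  rw [← h.1.diagonal_diag, Matrix.diagonal_mul_diagonal, ← Matrix.diagonal_one]
  congr 1
  funext i
  rcases h.2 i with h1 | h1 <;> simp [h1]

/-- For a signature-symmetric system, `y_b(τ) · u_a(t - τ) - u_b(τ) · y_a(t - τ)` is the derivative
of `-x_b(τ) · S x_a(t - τ)`. -/
lemma isReciprocal_externalBehavior {n d : ℕ} {A S : Matrix (Fin d) (Fin d) ℝ}
    {B : Matrix (Fin d) (Fin n) ℝ} {C : Matrix (Fin n) (Fin d) ℝ} {D : Matrix (Fin n) (Fin n) ℝ}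
    (hS : IsSignature S) (hA : A * S = S * A.transpose) (hB : S * C.transpose = B)
    (hD : D = D.transpose) : IsReciprocal (externalBehavior A B C D) := by
  have hSS := hS.mul_self
  have hSt : S.transpose = S := hS.1.isSymm
  have hSA : A.transpose * S = S * A := by
    calc A.transpose * S = S * (S * A.transpose) * S := by
          rw [← Matrix.mul_assoc, hSS, Matrix.one_mul]
      _ = S * A := by rw [← hA, Matrix.mul_assoc, Matrix.mul_assoc, hSS, Matrix.mul_one]
  have hSB : S * B = C.transpose := by rw [← hB, ← Matrix.mul_assoc, hSS, Matrix.one_mul]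
  have hBS : B.transpose * S = C := by
    rw [← hB, Matrix.transpose_mul, hSt, Matrix.mul_assoc, hSS, Matrix.mul_one,
      Matrix.transpose_transpose]
  rintro ⟨ua, ya⟩ ⟨ha, hua, hya⟩ ⟨ub, yb⟩ ⟨hb, hub, hyb⟩
  obtain ⟨xa, Ta, hxa, hxa0, hoa⟩ := exists_state_of_mem_DPlus ha hua hya
  obtain ⟨xb, Tb, hxb, hxb0, hob⟩ := exists_state_of_mem_DPlus hb hub hyb
  obtain ⟨huac, Tua, hua0⟩ := hua
  obtain ⟨hyac, Tya, hya0⟩ := hya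
  obtain ⟨hubc, Tub, hub0⟩ := hub
  obtain ⟨hybc, Tyb, hyb0⟩ := hyb
  have hxac : Continuous xa := continuous_iff_continuousAt.2 fun t => (hxa t).continuousAt
  have hxbc : Continuous xb := continuous_iff_continuousAt.2 fun t => (hxb t).continuousAt
  funext t
  change ∫ τ, yb τ ⬝ᵥ ua (t - τ) = ∫ τ, ub τ ⬝ᵥ ya (t - τ)
  have hI1 := integrable_dotProduct_comp_sub hybc.continuous huac.continuous hyb0 hua0 t
  have hI2 := integrable_dotProduct_comp_sub hubc.continuous hyac.continuous hub0 hya0 t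
  have hI3 : Integrable fun τ => xb τ ⬝ᵥ S.mulVec (xa (t - τ)) :=
    integrable_dotProduct_comp_sub (w := fun s => S.mulVec (xa s)) hxbc
      (continuous_const.matrix_mulVec hxac) hxb0
      (fun s hs => by rw [hxa0 s hs, Matrix.mulVec_zero]) t
  have hd : ∀ τ, HasDerivAt (fun τ => xb τ ⬝ᵥ S.mulVec (xa (t - τ)))
      (ub τ ⬝ᵥ ya (t - τ) - yb τ ⬝ᵥ ua (t - τ)) τ := by
    intro τ
    have h1 : HasDerivAt (fun τ => xa (t - τ))
        (-(A.mulVec (xa (t - τ)) + B.mulVec (ua (t - τ)))) τ := by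
      refine ((hxa (t - τ)).scomp τ ((hasDerivAt_id τ).const_sub t)).congr_deriv ?_
      rw [neg_smul, one_smul]
    have h2 : HasDerivAt (fun τ => S.mulVec (xa (t - τ)))
        (S.mulVec (-(A.mulVec (xa (t - τ)) + B.mulVec (ua (t - τ))))) τ :=
      (LinearMap.toContinuousLinearMap S.mulVecLin).hasFDerivAt.comp_hasDerivAt τ h1
    have h3 : HasDerivAt (fun τ => xb τ ⬝ᵥ S.mulVec (xa (t - τ)))
        ((A.mulVec (xb τ) + B.mulVec (ub τ)) ⬝ᵥ S.mulVec (xa (t - τ)) +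
          xb τ ⬝ᵥ S.mulVec (-(A.mulVec (xa (t - τ)) + B.mulVec (ua (t - τ))))) τ := by
      simp only [dotProduct]
      rw [← Finset.sum_add_distrib]
      exact HasDerivAt.fun_sum fun i _ =>
        (hasDerivAt_pi.1 (hxb τ) i).mul (hasDerivAt_pi.1 h2 i)
    refine h3.congr_deriv ?_
    rw [hoa, hob]
    have hadj : ∀ {k l : ℕ} (M : Matrix (Fin k) (Fin l) ℝ) (v : Fin l → ℝ) (w : Fin k → ℝ),
        M.mulVec v ⬝ᵥ w = v ⬝ᵥ M.transpose.mulVec w := fun M v w => by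
      rw [Matrix.dotProduct_mulVec, Matrix.vecMul_transpose]
    simp only [Matrix.mulVec_neg, Matrix.mulVec_add, Matrix.mulVec_mulVec, add_dotProduct,
      dotProduct_add, dotProduct_neg, hadj, hSA, hBS, hSB, ← hD]
    ring
  have h0 := integral_eq_zero_of_hasDerivAt_of_integrable hd (hI2.sub hI1) hI3
  rw [integral_sub hI2 hI1, sub_eq_zero] at h0
  exact h0.symm

end Behavioral

end

theorem theorem4p2 (n : ℕ) (P Q : Matrix (Fin n) (Fin n) (Polynomial ℝ)) (hQ : Q.det ≠ 0)
    (hproper : ∀ i j, Behavioral.IsProperRat (Behavioral.transferMatrix P Q i j)) :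
    Behavioral.IsReciprocal (Behavioral.ioBehavior P Q) ↔
      ∃ (d : ℕ) (A : Matrix (Fin d) (Fin d) ℝ) (B : Matrix (Fin d) (Fin n) ℝ)
        (C : Matrix (Fin n) (Fin d) ℝ) (D : Matrix (Fin n) (Fin n) ℝ)
        (S : Matrix (Fin d) (Fin d) ℝ),
        Behavioral.IsSignature S ∧
          Behavioral.ioBehavior P Q = Behavioral.externalBehavior A B C D ∧
          A * S = S * A.transpose ∧ S * C.transpose = B ∧ D = D.transpose := by
  constructor
  · intro h
    exact Behavioral.exists_signature_realization hQ hproper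
      (Behavioral.mul_transpose_eq_of_isReciprocal hQ h)
  · rintro ⟨d, A, B, C, D, S, hS, hext, hA, hB, hD⟩
    rw [hext]
    exact Behavioral.isReciprocal_externalBehavior hS hA hB hD
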